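/- For $k\in\mathbb Z_{\ge 0}\cup\{\infty\}$ write $(a;q)_k=\prod_{0\le j<k}(1-aq^j)$, and let \[ G(q)=\sum_{k=0}^\infty\frac{q^{k^2}}{(q;q)_k},\qquad H(q)=\sum_{k=0}^\infty\frac{q^{k(k+1)}}{(q;q)_k},\qquad F(q)=\prod_{j=0}^\infty\frac{1-q^{8j+8}}{1-q^{2j+2}}, \] \[ \tilde G(q)=\prod_{j=0}^\infty\frac1{(1-q^{5j+1})(1-q^{5j+4})},\qquad \tilde H(q)=\prod_{j=0}^\infty\frac1{(1-q^{5j+2})(1-q^{5j+3})}. \] Let either $q$ be a complex number with $|q|<1$, or let $q$ be the indeterminate of the ring $R[[q]]$ of formal power series over a commutative ring $R$ with a Hausdorff topology (for instance the discrete one), where sums and products converge in the topology of coefficientwise convergence. Then all these sums and products, as well as $(q^n;q^5)_\infty$ for $n\ge1$, converge, the elements $1-q^n$ and $(q^n;q^5)_\infty$ with $n\ge 1$ are invertible, and the Rogers–Ramanujan identities hold: \[ G(q)=\tilde G(q)=\frac1{(q;q^5)_\infty(q^4;q^5)_\infty},\qquad H(q)=\tilde H(q)=\frac1{(q^2;q^5)_\infty(q^3;q^5)_\infty}.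 \] Moreover, both the pair $(G,H)$ and the pair $(\tilde G,\tilde H)$ take the value $(1,1)$ at $q=0$ and satisfy Rogers' functional equations \[ G(q)=F(q)\bigl(G(q^{16})+qH(-q^4)\bigr),\qquad H(q)=F(q)\bigl(G(-q^4)+q^3H(q^{16})\bigr), \] and any two pairs of formal power series in $R[[q]]$ that satisfy these functional equations and have constant terms $(1,1)$ are equal. -/

import Mathlib

open scoped PowerSeries.WithPiTopology

/-! The definitions below make sense at an element `q` of a commutative ring `A` with a topology.
They are used for a complex number `q` (where `Ring.inverse x = x⁻¹`), and for the
indeterminate `X` of the ring `R⟦X⟧` of formal power series. `Ring.inverse x` is the inverse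
of `x` whenever `x` is a unit. -/

/-- The finite `q`-Pochhammer symbol `(a;q)_k = ∏_{j=0}^{k-1} (1 - a q^j)`. -/
def qPochhammer {A : Type*} [CommRing A] (a q : A) (k : ℕ) : A :=
  ∏ j ∈ Finset.range k, (1 - a * q ^ j)

/-- The infinite `q`-Pochhammer symbol `(a;q)_∞ = ∏_{j=0}^∞ (1 - a q^j)`. -/
noncomputable def qPochhammerInf {A : Type*} [CommRing A] [TopologicalSpace A] (a q : A) : A :=
  ∏' j : ℕ, (1 - a * q ^ j)

namespace RogersRamanujan

/-- The term `q^{k²} / (q;q)_k`. -/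
noncomputable def sumTermG {A : Type*} [CommRing A] (q : A) (k : ℕ) : A :=
  q ^ (k ^ 2) * Ring.inverse (qPochhammer q q k)

/-- The term `q^{k(k+1)} / (q;q)_k`. -/
noncomputable def sumTermH {A : Type*} [CommRing A] (q : A) (k : ℕ) : A :=
  q ^ (k * (k + 1)) * Ring.inverse (qPochhammer q q k)

/-- The factor `1 / ((1 - q^{5j+1}) (1 - q^{5j+4}))`. -/
noncomputable def prodFactorG {A : Type*} [CommRing A] (q : A) (j : ℕ) : A :=
  Ring.inverse ((1 - q ^ (5 * j + 1)) * (1 - q ^ (5 * j + 4)))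

/-- The factor `1 / ((1 - q^{5j+2}) (1 - q^{5j+3}))`. -/
noncomputable def prodFactorH {A : Type*} [CommRing A] (q : A) (j : ℕ) : A :=
  Ring.inverse ((1 - q ^ (5 * j + 2)) * (1 - q ^ (5 * j + 3)))

/-- The factor `(1 - q^{8j+8}) / (1 - q^{2j+2})`. -/
noncomputable def factorF {A : Type*} [CommRing A] (q : A) (j : ℕ) : A :=
  (1 - q ^ (8 * j + 8)) * Ring.inverse (1 - q ^ (2 * j + 2))

/-- The sum side `G(q) = ∑_{k ≥ 0} q^{k²} / (q;q)_k`. -/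
noncomputable def sumG {A : Type*} [CommRing A] [TopologicalSpace A] (q : A) : A :=
  ∑' k : ℕ, sumTermG q k

/-- The sum side `H(q) = ∑_{k ≥ 0} q^{k(k+1)} / (q;q)_k`. -/
noncomputable def sumH {A : Type*} [CommRing A] [TopologicalSpace A] (q : A) : A :=
  ∑' k : ℕ, sumTermH q k

/-- The product side `∏_{j ≥ 0} 1 / ((1 - q^{5j+1}) (1 - q^{5j+4}))`. -/
noncomputable def prodG {A : Type*} [CommRing A] [TopologicalSpace A] (q : A) : A :=
  ∏' j : ℕ, prodFactorG q j

/-- The product side `∏_{j ≥ 0} 1 / ((1 - q^{5j+2}) (1 - q^{5j+3}))`. -/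
noncomputable def prodH {A : Type*} [CommRing A] [TopologicalSpace A] (q : A) : A :=
  ∏' j : ℕ, prodFactorH q j

/-- `F(q) = ∏_{j ≥ 0} (1 - q^{8j+8}) / (1 - q^{2j+2})`. -/
noncomputable def F {A : Type*} [CommRing A] [TopologicalSpace A] (q : A) : A :=
  ∏' j : ℕ, factorF q j

/-- Every infinite sum and product that occurs in the identities converges at `q`, and the
denominators are invertible. -/
def Converges {A : Type*} [CommRing A] [TopologicalSpace A] (q : A) : Prop :=
  (∀ n : ℕ, 0 < n → IsUnit (1 - q ^ n)) ∧
  Summable (sumTermG q) ∧ Summable (sumTermH q) ∧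
  Multipliable (prodFactorG q) ∧ Multipliable (prodFactorH q) ∧ Multipliable (factorF q) ∧
  (∀ n : ℕ, 0 < n → Multipliable (fun j : ℕ => 1 - q ^ n * (q ^ 5) ^ j) ∧
    IsUnit (qPochhammerInf (q ^ n) (q ^ 5)))

/-- Rogers' equations at the complex number `q`, for two functions `G` and `H`. -/
def RogersEquationsAt (G H : ℂ → ℂ) (q : ℂ) : Prop :=
  G q = F q * (G (q ^ 16) + q * H (-q ^ 4)) ∧
  H q = F q * (G (-q ^ 4) + q ^ 3 * H (q ^ 16))

/-- Rogers' equations for two formal power series `G` and `H` in the indeterminate `q = X`. -/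
def RogersEquations {R : Type*} [CommRing R] [TopologicalSpace R] (G H : PowerSeries R) : Prop :=
  G = F (PowerSeries.X : PowerSeries R) *
    (PowerSeries.subst (PowerSeries.X ^ 16 : PowerSeries R) G +
      PowerSeries.X * PowerSeries.subst (-PowerSeries.X ^ 4 : PowerSeries R) H) ∧
  H = F (PowerSeries.X : PowerSeries R) *
    (PowerSeries.subst (-PowerSeries.X ^ 4 : PowerSeries R) G +
      PowerSeries.X ^ 3 * PowerSeries.subst (PowerSeries.X ^ 16 : PowerSeries R) H)

end RogersRamanujan

/-!
Rogers' equations express `(G, H)` at `q` through values at `q ^ 16` and `-q ^ 4`. Both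
substitutions contract towards `0` and `F` is bounded there, so two pairs of solutions that differ
by `O(q)` near `0` agree; for power series, the difference of two solutions with the same constant
terms is divisible by every power of `X`.

That the sums solve the equations rests on one mechanism: if a series with general term
`q ^ (n² + cn) / (q²;q²)_n` is multiplied by an infinite product that depends suitably on `n`,
Euler's expansion of the product gives a double series whose diagonals are Rogers–Szegő polynomials,
and at the arguments that occur these have a closed form. In this way `G` and `H` become an infinite
product times a single series over `n`, whose terms of even and of odd index are again values of `G`
and `H`, at `q ^ 16` and `-q ^ 4`. For the products, multiplication by `(q²;q²)_∞` clears the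
denominators and leaves theta functions, and by Jacobi's triple product the terms of even and of odd
index of a theta series are again theta series.

Both arguments work in every complete normed commutative ring in which `‖1‖ = 1`, at the points with
`‖q‖ < 1`. This covers `ℂ`, and also `ℤ⟦X⟧` with the norm `2^{-order}` and `q = X`; the map from
`ℤ⟦X⟧` to `R⟦X⟧` that sends `X` to a series without constant term is continuous and carries the
identities over.
-/

namespace RogersRamanujan

open Filter Topology Finset

/-! ### Pochhammer symbols -/

section Algebra

variable {A : Type*} [CommRing A]

lemma inverse_eq_of_mul_eq_one {a b : A} (h : a * b = 1) : Ring.inverse a = b := by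
  rw [← mul_one (Ring.inverse a), ← h, Ring.inverse_mul_cancel_left _ _ (.of_mul_eq_one b h)]

lemma qPochhammer_zero (a q : A) : qPochhammer a q 0 = 1 :=
  prod_range_zero _

lemma qPochhammer_succ (a q : A) (n : ℕ) :
    qPochhammer a q (n + 1) = qPochhammer a q n * (1 - a * q ^ n) :=
  prod_range_succ _ _

lemma qPochhammer_self_succ (q : A) (n : ℕ) :
    qPochhammer q q (n + 1) = qPochhammer q q n * (1 - q ^ (n + 1)) := by
  rw [qPochhammer_succ, pow_succ']

lemma qPochhammer_succ_left (a q : A) (n : ℕ) :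
    qPochhammer a q (n + 1) = (1 - a) * qPochhammer (a * q) q n := by
  simp only [qPochhammer, prod_range_succ', pow_succ', mul_assoc, pow_zero, mul_one]
  exact mul_comm _ _

lemma qPochhammer_mul_neg (a q : A) (n : ℕ) :
    qPochhammer a q n * qPochhammer (-a) q n = qPochhammer (a ^ 2) (q ^ 2) n := by
  simp only [qPochhammer, ← prod_mul_distrib]
  exact prod_congr rfl fun j _ => by ring

lemma qPochhammer_mul_eq_prod (a q : A) (k n : ℕ) :
    qPochhammer a q (k * n) = ∏ i ∈ range k, qPochhammer (a * q ^ i) (q ^ k) n := by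
  induction n with
  | zero => simp [qPochhammer]
  | succ n ih =>
    rw [mul_add_one, qPochhammer, prod_range_add, ← qPochhammer, ih]
    simp only [qPochhammer_succ, prod_mul_distrib]
    congr 1
    exact prod_congr rfl fun i _ => by ring

/-- The reciprocal `1 / (q;q)_n` of the denominators of the sum sides. -/
noncomputable def recip (q : A) (n : ℕ) : A :=
  Ring.inverse (qPochhammer q q n)

lemma recip_zero (q : A) : recip q 0 = 1 := by
  rw [recip, qPochhammer_zero, Ring.inverse_one]

variable [TopologicalSpace A]

/-- The denominator `(q;q⁵)_∞ (q⁴;q⁵)_∞` of the product side `prodG`. -/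
noncomputable def denG (q : A) : A :=
  qPochhammerInf q (q ^ 5) * qPochhammerInf (q ^ 4) (q ^ 5)

/-- The denominator `(q²;q⁵)_∞ (q³;q⁵)_∞` of the product side `prodH`. -/
noncomputable def denH (q : A) : A :=
  qPochhammerInf (q ^ 2) (q ^ 5) * qPochhammerInf (q ^ 3) (q ^ 5)

end Algebra

section Normed

variable {A : Type*} [NormedCommRing A] [NormOneClass A]

lemma norm_pow_lt_one {q : A} (hq : ‖q‖ < 1) {n : ℕ} (hn : n ≠ 0) : ‖q ^ n‖ < 1 :=
  (norm_pow_le q n).trans_lt (pow_lt_one₀ (norm_nonneg q) hq hn)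

lemma norm_pow_le_one {q : A} (hq : ‖q‖ < 1) (n : ℕ) : ‖q ^ n‖ ≤ 1 :=
  (norm_pow_le q n).trans (pow_le_one₀ (norm_nonneg q) hq.le)

lemma norm_pow_le_pow_of_le {q : A} (hq : ‖q‖ < 1) {m n : ℕ} (h : m ≤ n) :
    ‖q ^ n‖ ≤ ‖q‖ ^ m :=
  (norm_pow_le q n).trans (pow_le_pow_of_le_one (norm_nonneg q) hq.le h)

omit [NormOneClass A] in
lemma norm_mul_le_of_norm_le_one {a b : A} (hb : ‖b‖ ≤ 1) : ‖a * b‖ ≤ ‖a‖ :=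
  (norm_mul_le a b).trans (mul_le_of_le_one_right (norm_nonneg a) hb)

lemma norm_mul_pow_lt_one {a q : A} (ha : ‖a‖ < 1) (hq : ‖q‖ < 1) (n : ℕ) : ‖a * q ^ n‖ < 1 :=
  (norm_mul_le_of_norm_le_one (norm_pow_le_one hq n)).trans_lt ha

lemma summable_norm_mul_pow {q : A} (hq : ‖q‖ < 1) (a : A) :
    Summable fun j : ℕ => ‖a * q ^ j‖ :=
  ((summable_geometric_of_lt_one (norm_nonneg q) hq).mul_left ‖a‖).of_nonneg_of_le
    (fun _ => norm_nonneg _) fun j => (norm_mul_le _ _).trans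
      (mul_le_mul_of_nonneg_left (norm_pow_le q j) (norm_nonneg a))

variable [CompleteSpace A]

lemma norm_inverse_one_sub_le {t : A} (ht : ‖t‖ < 1) :
    ‖Ring.inverse (1 - t)‖ ≤ (1 - ‖t‖)⁻¹ := by
  rw [← geom_series_eq_inverse t ht]
  simpa only [norm_one, sub_self, zero_add] using tsum_geometric_le_of_norm_lt_one t ht

omit [NormOneClass A] in
lemma inverse_one_sub_eq {t : A} (ht : ‖t‖ < 1) :
    Ring.inverse (1 - t) = 1 + t * Ring.inverse (1 - t) := by
  linear_combination Ring.mul_inverse_cancel _ (isUnit_one_sub_of_norm_lt_one ht)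

lemma multipliable_one_sub {t : ℕ → A} (ht : Summable fun j => ‖t j‖) :
    Multipliable fun j => 1 - t j := by
  simpa only [sub_eq_add_neg] using
    multipliable_one_add_of_summable (f := fun j => -t j) (by simpa only [norm_neg])

lemma multipliable_inverse_one_sub {t : ℕ → A} (ht : Summable fun j => ‖t j‖)
    (h1 : ∀ j, ‖t j‖ < 1) : Multipliable fun j => Ring.inverse (1 - t j) := by
  have hsum : Summable fun j => ‖t j * Ring.inverse (1 - t j)‖ := by
    refine Summable.of_norm_bounded_eventually_nat (ht.mul_right 2) ?_
    filter_upwards [ht.tendsto_atTop_zero.eventually (ge_mem_nhds one_half_pos)] with j hj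
    rw [norm_norm]
    refine (norm_mul_le _ _).trans (mul_le_mul_of_nonneg_left ?_ (norm_nonneg _))
    refine (norm_inverse_one_sub_le (h1 j)).trans ?_
    rw [inv_le_comm₀ (by linarith) two_pos]
    linarith
  exact (multipliable_one_add_of_summable hsum).congr fun j => (inverse_one_sub_eq (h1 j)).symm

lemma tprod_one_sub_mul_tprod_inverse {t : ℕ → A} (ht : Summable fun j => ‖t j‖)
    (h1 : ∀ j, ‖t j‖ < 1) : (∏' j, (1 - t j)) * ∏' j, Ring.inverse (1 - t j) = 1 := by
  rw [← (multipliable_one_sub ht).tprod_mul (multipliable_inverse_one_sub ht h1)]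
  simp only [fun j => Ring.mul_inverse_cancel _ (isUnit_one_sub_of_norm_lt_one (h1 j)), tprod_one]

lemma isUnit_qPochhammer {a q : A} (ha : ‖a‖ < 1) (hq : ‖q‖ < 1) (n : ℕ) :
    IsUnit (qPochhammer a q n) :=
  IsUnit.prod_iff.2 fun j _ => isUnit_one_sub_of_norm_lt_one (norm_mul_pow_lt_one ha hq j)

lemma multipliable_qPochhammer {q : A} (hq : ‖q‖ < 1) (a : A) :
    Multipliable fun j : ℕ => 1 - a * q ^ j :=
  multipliable_one_sub (summable_norm_mul_pow hq a)

lemma tendsto_qPochhammer {q : A} (hq : ‖q‖ < 1) (a : A) :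
    Tendsto (qPochhammer a q) atTop (𝓝 (qPochhammerInf a q)) :=
  (multipliable_qPochhammer hq a).hasProd.tendsto_prod_nat

lemma isUnit_qPochhammerInf {a q : A} (ha : ‖a‖ < 1) (hq : ‖q‖ < 1) :
    IsUnit (qPochhammerInf a q) :=
  IsUnit.of_mul_eq_one _ (tprod_one_sub_mul_tprod_inverse (summable_norm_mul_pow hq a)
    (norm_mul_pow_lt_one ha hq))

lemma hasProd_inverse_qPochhammer {a q : A} (ha : ‖a‖ < 1) (hq : ‖q‖ < 1) :
    HasProd (fun j : ℕ => Ring.inverse (1 - a * q ^ j)) (Ring.inverse (qPochhammerInf a q)) := by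
  have hsum := summable_norm_mul_pow hq a
  have hlt := norm_mul_pow_lt_one ha hq
  convert (multipliable_inverse_one_sub hsum hlt).hasProd using 1
  exact inverse_eq_of_mul_eq_one (tprod_one_sub_mul_tprod_inverse hsum hlt)

lemma qPochhammerInf_eq_one_sub_mul {q : A} (hq : ‖q‖ < 1) (a : A) :
    qPochhammerInf a q = (1 - a) * qPochhammerInf (a * q) q := by
  refine tendsto_nhds_unique ((tendsto_add_atTop_iff_nat 1).2 (tendsto_qPochhammer hq a)) ?_
  simp only [qPochhammer_succ_left]
  exact (tendsto_qPochhammer hq (a * q)).const_mul _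

lemma qPochhammerInf_eq_qPochhammer_mul {q : A} (hq : ‖q‖ < 1) (a : A) (n : ℕ) :
    qPochhammerInf a q = qPochhammer a q n * qPochhammerInf (a * q ^ n) q := by
  induction n with
  | zero => rw [qPochhammer_zero, pow_zero, mul_one, one_mul]
  | succ n ih =>
    rw [ih, qPochhammerInf_eq_one_sub_mul hq (a * q ^ n), qPochhammer_succ, pow_succ]
    ring_nf

lemma qPochhammerInf_mul_neg {q : A} (hq : ‖q‖ < 1) (a : A) :
    qPochhammerInf a q * qPochhammerInf (-a) q = qPochhammerInf (a ^ 2) (q ^ 2) := by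
  refine tendsto_nhds_unique ((tendsto_qPochhammer hq a).mul (tendsto_qPochhammer hq (-a))) ?_
  simp only [qPochhammer_mul_neg]
  exact tendsto_qPochhammer (norm_pow_lt_one hq two_ne_zero) (a ^ 2)

lemma qPochhammerInf_eq_prod {q : A} (hq : ‖q‖ < 1) (a : A) {k : ℕ} (hk : k ≠ 0) :
    qPochhammerInf a q = ∏ i ∈ range k, qPochhammerInf (a * q ^ i) (q ^ k) := by
  refine tendsto_nhds_unique ((tendsto_qPochhammer hq a).comp
    (tendsto_id.const_mul_atTop' (Nat.pos_of_ne_zero hk))) ?_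
  simp only [Function.comp_def, id, qPochhammer_mul_eq_prod]
  exact tendsto_finsetProd _ fun i _ => tendsto_qPochhammer (norm_pow_lt_one hq hk) _

lemma qPochhammerInf_eq_mul {q : A} (hq : ‖q‖ < 1) (a : A) :
    qPochhammerInf a q = qPochhammerInf a (q ^ 2) * qPochhammerInf (a * q) (q ^ 2) := by
  rw [qPochhammerInf_eq_prod hq a two_ne_zero, prod_range_succ, prod_range_one, pow_zero, mul_one,
    pow_one]

lemma qPochhammer_mul_recip {q : A} (hq : ‖q‖ < 1) (n : ℕ) :
    qPochhammer q q n * recip q n = 1 :=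
  Ring.mul_inverse_cancel _ (isUnit_qPochhammer hq hq n)

lemma one_sub_pow_mul_recip_succ {q : A} (hq : ‖q‖ < 1) (n : ℕ) :
    (1 - q ^ (n + 1)) * recip q (n + 1) = recip q n := by
  have hn := qPochhammer_mul_recip hq n
  have hn1 := qPochhammer_mul_recip hq (n + 1)
  rw [qPochhammer_self_succ] at hn1
  linear_combination recip q n * hn1 - (1 - q ^ (n + 1)) * recip q (n + 1) * hn

lemma tendsto_recip {q : A} (hq : ‖q‖ < 1) :
    Tendsto (recip q) atTop (𝓝 (Ring.inverse (qPochhammerInf q q))) :=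
  (NormedRing.inverse_continuousAt (isUnit_qPochhammerInf hq hq).unit).tendsto.comp
    (tendsto_qPochhammer hq q)

lemma exists_norm_recip_le {q : A} (hq : ‖q‖ < 1) : ∃ C : ℝ, ∀ n, ‖recip q n‖ ≤ C := by
  obtain ⟨C, hC⟩ := (tendsto_recip hq).norm.bddAbove_range
  exact ⟨C, fun n => hC ⟨n, rfl⟩⟩

lemma summable_pow_mul_recip {q p : A} (hq : ‖q‖ < 1) (hp : ‖p‖ < 1) {f g : ℕ → ℕ}
    (hf : ∀ n, n ≤ f n) : Summable fun n => q ^ f n * recip p (g n) := by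
  obtain ⟨C, hC⟩ := exists_norm_recip_le hp
  refine .of_norm_bounded ((summable_geometric_of_lt_one (norm_nonneg q) hq).mul_right C)
    fun n => (norm_mul_le _ _).trans ?_
  gcongr
  exacts [norm_pow_le_pow_of_le hq (hf n), hC _]

lemma hasProd_inverse_mul {a b q : A} (ha : ‖a‖ < 1) (hb : ‖b‖ < 1) (hq : ‖q‖ < 1) :
    HasProd (fun j : ℕ => Ring.inverse ((1 - a * q ^ j) * (1 - b * q ^ j)))
      (Ring.inverse (qPochhammerInf a q * qPochhammerInf b q)) := by
  simp only [Ring.mul_inverse_rev]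
  simpa only [mul_comm] using
    (hasProd_inverse_qPochhammer ha hq).mul (hasProd_inverse_qPochhammer hb hq)

lemma hasProd_prodFactorG {q : A} (hq : ‖q‖ < 1) :
    HasProd (prodFactorG q) (Ring.inverse (denG q)) := by
  refine (hasProd_inverse_mul hq (norm_pow_lt_one hq four_ne_zero)
    (norm_pow_lt_one hq (by norm_num))).congr_fun fun j => ?_
  rw [prodFactorG, ← pow_mul, ← pow_succ', ← pow_add, add_comm 4]

lemma hasProd_prodFactorH {q : A} (hq : ‖q‖ < 1) :
    HasProd (prodFactorH q) (Ring.inverse (denH q)) := by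
  refine (hasProd_inverse_mul (norm_pow_lt_one hq two_ne_zero) (norm_pow_lt_one hq three_ne_zero)
    (norm_pow_lt_one hq (by norm_num))).congr_fun fun j => ?_
  rw [prodFactorH, ← pow_mul, ← pow_add, ← pow_add, add_comm 2, add_comm 3]

lemma hasProd_factorF {q : A} (hq : ‖q‖ < 1) :
    HasProd (factorF q)
      (qPochhammerInf (q ^ 8) (q ^ 8) * Ring.inverse (qPochhammerInf (q ^ 2) (q ^ 2))) := by
  have hq2 : ‖q ^ 2‖ < 1 := norm_pow_lt_one hq two_ne_zero
  refine ((multipliable_qPochhammer (norm_pow_lt_one hq (by norm_num)) (q ^ 8)).hasProd.mul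
    (hasProd_inverse_qPochhammer hq2 hq2)).congr_fun fun j => ?_
  rw [factorF, ← pow_mul, ← pow_mul, ← pow_add, ← pow_add, add_comm 8, add_comm 2]

lemma prodG_eq {q : A} (hq : ‖q‖ < 1) : prodG q = Ring.inverse (denG q) :=
  (hasProd_prodFactorG hq).tprod_eq

lemma prodH_eq {q : A} (hq : ‖q‖ < 1) : prodH q = Ring.inverse (denH q) :=
  (hasProd_prodFactorH hq).tprod_eq

lemma prodG_mul_denG {q : A} (hq : ‖q‖ < 1) : prodG q * denG q = 1 := by
  have hq5 : ‖q ^ 5‖ < 1 := norm_pow_lt_one hq (by norm_num)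
  rw [prodG_eq hq, Ring.inverse_mul_cancel]
  exact (isUnit_qPochhammerInf hq hq5).mul
    (isUnit_qPochhammerInf (norm_pow_lt_one hq four_ne_zero) hq5)

lemma prodH_mul_denH {q : A} (hq : ‖q‖ < 1) : prodH q * denH q = 1 := by
  have hq5 : ‖q ^ 5‖ < 1 := norm_pow_lt_one hq (by norm_num)
  rw [prodH_eq hq, Ring.inverse_mul_cancel]
  exact (isUnit_qPochhammerInf (norm_pow_lt_one hq two_ne_zero) hq5).mul
    (isUnit_qPochhammerInf (norm_pow_lt_one hq three_ne_zero) hq5)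

lemma F_mul_qPochhammerInf {q : A} (hq : ‖q‖ < 1) :
    F q * qPochhammerInf (q ^ 2) (q ^ 2) = qPochhammerInf (q ^ 8) (q ^ 8) := by
  have hq2 : ‖q ^ 2‖ < 1 := norm_pow_lt_one hq two_ne_zero
  rw [F, (hasProd_factorF hq).tprod_eq, mul_assoc,
    Ring.inverse_mul_cancel _ (isUnit_qPochhammerInf hq2 hq2), mul_one]

theorem converges_of_norm_lt_one {q : A} (hq : ‖q‖ < 1) : Converges q :=
  ⟨fun _ hn => isUnit_one_sub_of_norm_lt_one (norm_pow_lt_one hq hn.ne'),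
    summable_pow_mul_recip hq hq fun n => Nat.le_self_pow two_ne_zero n,
    summable_pow_mul_recip hq hq fun n => Nat.le_mul_of_pos_right n n.succ_pos,
    (hasProd_prodFactorG hq).multipliable, (hasProd_prodFactorH hq).multipliable,
    (hasProd_factorF hq).multipliable,
    fun _ hn => ⟨multipliable_qPochhammer (norm_pow_lt_one hq (by norm_num)) _,
      isUnit_qPochhammerInf (norm_pow_lt_one hq hn.ne') (norm_pow_lt_one hq (by norm_num))⟩⟩

end Normed

/-! ### Jacobi's triple product -/

section Algebra

variable {A : Type*} [CommRing A]

lemma sq_eq_two_mul_choose_two_add (k : ℕ) : k ^ 2 = 2 * k.choose 2 + k := by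
  induction k with
  | zero => rfl
  | succ k ih =>
    rw [Nat.choose_succ_succ' k 1, Nat.choose_one_right]
    linarith

/-- The `k`-th term `c^k q^{k(k-1)/2} / (q;q)_k` of Euler's expansion of `(-c;q)_∞`. -/
noncomputable def eulerTerm (q c : A) (k : ℕ) : A :=
  c ^ k * q ^ k.choose 2 * recip q k

/-- The `m`-th term of Cauchy's series `∑ q^{m² + mt} / ((q;q)_m (q;q)_{m+t})`, which collects
the products of terms of two Euler expansions with a given difference `t` of indices. -/
noncomputable def cauchyTerm (q : A) (t m : ℕ) : A :=
  q ^ (m ^ 2 + m * t) * recip q m * recip q (m + t)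

/-- The triangular number `n(n+1)/2` of an integer. -/
def tri (n : ℤ) : ℕ := (n * (n + 1) / 2).toNat

lemma two_mul_tri (n : ℤ) : 2 * (tri n : ℤ) = n * (n + 1) := by
  have hnonneg : 0 ≤ n * (n + 1) := by
    rcases le_or_gt 0 n with h | h
    · positivity
    · exact mul_nonneg_of_nonpos_of_nonpos h.le (by lia)
  rw [tri, Int.toNat_of_nonneg (by lia)]
  exact Int.mul_ediv_cancel' (Int.even_mul_succ_self n).two_dvd

lemma tri_natCast (n : ℕ) : tri n = n + n.choose 2 := by
  have htri := two_mul_tri n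
  have hsq := sq_eq_two_mul_choose_two_add n
  zify at hsq ⊢
  linarith

lemma tri_neg_natCast (n : ℕ) : tri (-n) = n.choose 2 := by
  have htri := two_mul_tri (-n)
  have hsq := sq_eq_two_mul_choose_two_add n
  zify at hsq ⊢
  linarith

/-- The term `a^{n(n+1)/2} b^{n(n-1)/2}` of the theta series. -/
def thetaTerm (a b : A) (n : ℤ) : A := a ^ tri n * b ^ tri (-n)

/-- The theta function `∑ a^{n(n+1)/2} b^{n(n-1)/2}` in its product form
`(-a;ab)_∞ (-b;ab)_∞ (ab;ab)_∞`. -/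
noncomputable def thetaProd [TopologicalSpace A] (a b : A) : A :=
  qPochhammerInf (-a) (a * b) * qPochhammerInf (-b) (a * b) * qPochhammerInf (a * b) (a * b)

/-- Pairs of natural numbers correspond to their difference together with their minimum. -/
def diffMinEquiv : ℕ × ℕ ≃ ℤ × ℕ where
  toFun p := ((p.1 : ℤ) - p.2, min p.1 p.2)
  invFun p := (p.2 + p.1.toNat, p.2 + (-p.1).toNat)
  left_inv p := by ext <;> dsimp only <;> omega
  right_inv p := by ext <;> dsimp only <;> omega

lemma eulerTerm_mul_eulerTerm (a b : A) (m n : ℕ) :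
    eulerTerm (a * b) a (m + n) * eulerTerm (a * b) b m =
      a ^ (n + n.choose 2) * b ^ n.choose 2 * cauchyTerm (a * b) n m := by
  have hexp : m + (m + n).choose 2 + m.choose 2 = n.choose 2 + (m ^ 2 + m * n) := by
    have hm := sq_eq_two_mul_choose_two_add m
    have hn := sq_eq_two_mul_choose_two_add n
    have hmn := sq_eq_two_mul_choose_two_add (m + n)
    nlinarith
  calc eulerTerm (a * b) a (m + n) * eulerTerm (a * b) b m
    _ = a ^ n * (a * b) ^ (m + (m + n).choose 2 + m.choose 2) *
          (recip (a * b) m * recip (a * b) (m + n)) := by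
        rw [eulerTerm, eulerTerm, pow_add (a * b), pow_add (a * b), mul_pow a b m]
        ring
    _ = a ^ (n + n.choose 2) * b ^ n.choose 2 * cauchyTerm (a * b) n m := by
        rw [hexp, cauchyTerm, pow_add (a * b), mul_pow a b (n.choose 2)]
        ring

lemma eulerTerm_diffMinEquiv_symm (a b : A) (p : ℤ × ℕ) :
    eulerTerm (a * b) a (diffMinEquiv.symm p).1 * eulerTerm (a * b) b (diffMinEquiv.symm p).2 =
      thetaTerm a b p.1 * cauchyTerm (a * b) p.1.natAbs p.2 := by
  obtain ⟨n, m⟩ := p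
  obtain ⟨k, rfl | rfl⟩ := n.eq_nat_or_neg <;>
    simp only [diffMinEquiv, Equiv.coe_fn_symm_mk, thetaTerm, tri_natCast, tri_neg_natCast,
      neg_neg, Int.natAbs_neg, Int.natAbs_natCast, Int.toNat_natCast, Int.toNat_neg_natCast,
      add_zero]
  · exact eulerTerm_mul_eulerTerm a b m k
  · rw [mul_comm, mul_comm a b, eulerTerm_mul_eulerTerm, mul_comm (b ^ _)]

end Algebra

section Normed

variable {A : Type*} [NormedCommRing A] [NormOneClass A] [CompleteSpace A]

omit [CompleteSpace A] in
lemma norm_eulerTerm_le {q : A} (hq : ‖q‖ < 1) {C : ℝ} (hC : ∀ n, ‖recip q n‖ ≤ C) (c : A)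
    (k : ℕ) : ‖eulerTerm q c k‖ ≤ ‖c‖ ^ k * C := by
  refine (norm_mul_le _ _).trans (mul_le_mul ?_ (hC k) (norm_nonneg _) (by positivity))
  exact (norm_mul_le_of_norm_le_one (norm_pow_le_one hq _)).trans (norm_pow_le c k)

lemma summable_norm_eulerTerm {q c : A} (hq : ‖q‖ < 1) (hc : ‖c‖ < 1) :
    Summable fun k => ‖eulerTerm q c k‖ := by
  obtain ⟨C, hC⟩ := exists_norm_recip_le hq
  exact ((summable_geometric_of_lt_one (norm_nonneg c) hc).mul_right C).of_nonneg_of_le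
    (fun _ => norm_nonneg _) (norm_eulerTerm_le hq hC c)

lemma tsum_eulerTerm_eq_one_add_mul {q c : A} (hq : ‖q‖ < 1) (hc : ‖c‖ < 1) :
    ∑' k, eulerTerm q c k = (1 + c) * ∑' k, eulerTerm q (c * q) k := by
  have hsum := (summable_norm_eulerTerm hq hc).of_norm
  have hsum' : Summable (eulerTerm q (c * q)) :=
    (summable_norm_eulerTerm hq ((norm_mul_le_of_norm_le_one hq.le).trans_lt hc)).of_norm
  have hdiff : ∑' k, (eulerTerm q c k - eulerTerm q (c * q) k) =
      c * ∑' k, eulerTerm q (c * q) k := by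
    rw [(hsum.sub hsum').tsum_eq_zero_add, ← hsum'.tsum_mul_left]
    simp only [eulerTerm, pow_zero, sub_self, zero_add]
    refine tsum_congr fun k => ?_
    rw [← one_sub_pow_mul_recip_succ hq k, Nat.choose_succ_succ' k 1, Nat.choose_one_right]
    ring
  rw [hsum.tsum_sub hsum'] at hdiff
  linear_combination hdiff

lemma tsum_eulerTerm_eq_qPochhammer_mul {q c : A} (hq : ‖q‖ < 1) (hc : ‖c‖ < 1) (n : ℕ) :
    ∑' k, eulerTerm q c k = qPochhammer (-c) q n * ∑' k, eulerTerm q (c * q ^ n) k := by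
  induction n with
  | zero => rw [qPochhammer_zero, pow_zero, mul_one, one_mul]
  | succ n ih =>
    rw [ih, tsum_eulerTerm_eq_one_add_mul hq (norm_mul_pow_lt_one hc hq n), qPochhammer_succ,
      pow_succ]
    ring_nf

lemma tendsto_tsum_eulerTerm_mul_pow {q c : A} (hq : ‖q‖ < 1) (hc : ‖c‖ < 1) :
    Tendsto (fun n => ∑' k, eulerTerm q (c * q ^ n) k) atTop (𝓝 1) := by
  obtain ⟨C, hC⟩ := exists_norm_recip_le hq
  have hzero : ∑' k, eulerTerm q (0 : A) k = 1 := by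
    rw [tsum_eq_single 0 fun k hk => by simp [eulerTerm, hk]]
    simp [eulerTerm, recip_zero]
  have hlim : Tendsto (fun n => c * q ^ n) atTop (𝓝 0) := by
    simpa only [mul_zero] using (tendsto_pow_atTop_nhds_zero_of_norm_lt_one hq).const_mul c
  rw [← hzero]
  refine tendsto_tsum_of_dominated_convergence (bound := fun k => ‖c‖ ^ k * C)
    ((summable_geometric_of_lt_one (norm_nonneg c) hc).mul_right C)
    (fun k => ((hlim.pow k).mul_const _).mul_const _)
    (.of_forall fun n k => (norm_eulerTerm_le hq hC _ k).trans ?_)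
  gcongr
  · exact (norm_nonneg _).trans (hC 0)
  · exact norm_mul_le_of_norm_le_one (norm_pow_le_one hq n)

/-- Euler's expansion. -/
theorem qPochhammerInf_neg_eq_tsum {q c : A} (hq : ‖q‖ < 1) (hc : ‖c‖ < 1) :
    qPochhammerInf (-c) q = ∑' k, eulerTerm q c k := by
  have hlim := (tendsto_qPochhammer hq (-c)).mul (tendsto_tsum_eulerTerm_mul_pow hq hc)
  simp only [← tsum_eulerTerm_eq_qPochhammer_mul hq hc, mul_one] at hlim
  exact tendsto_nhds_unique hlim tendsto_const_nhds

omit [CompleteSpace A] in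
lemma norm_cauchyTerm_le {q : A} (hq : ‖q‖ < 1) {C : ℝ} (hC : ∀ n, ‖recip q n‖ ≤ C) (t m : ℕ) :
    ‖cauchyTerm q t m‖ ≤ ‖q‖ ^ m * C * C := by
  have hC0 : 0 ≤ C := (norm_nonneg _).trans (hC 0)
  refine (norm_mul_le _ _).trans (mul_le_mul ?_ (hC _) (norm_nonneg _) (by positivity))
  refine (norm_mul_le _ _).trans (mul_le_mul ?_ (hC _) (norm_nonneg _) (by positivity))
  exact norm_pow_le_pow_of_le hq (by nlinarith [Nat.le_self_pow two_ne_zero m])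

lemma summable_cauchyTerm {q : A} (hq : ‖q‖ < 1) (t : ℕ) : Summable (cauchyTerm q t) := by
  obtain ⟨C, hC⟩ := exists_norm_recip_le hq
  exact Summable.of_norm_bounded
    (((summable_geometric_of_lt_one (norm_nonneg q) hq).mul_right C).mul_right C)
    (norm_cauchyTerm_le hq hC t)

lemma tendsto_tsum_cauchyTerm {q : A} (hq : ‖q‖ < 1) :
    Tendsto (fun t => ∑' m, cauchyTerm q t m) atTop
      (𝓝 (Ring.inverse (qPochhammerInf q q))) := by
  obtain ⟨C, hC⟩ := exists_norm_recip_le hq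
  set P := Ring.inverse (qPochhammerInf q q)
  have hterm (m : ℕ) :
      Tendsto (fun t => cauchyTerm q t m) atTop (𝓝 (if m = 0 then P else 0)) := by
    have hrecip : Tendsto (fun t => recip q (m + t)) atTop (𝓝 P) := by
      simpa only [add_comm m] using (tendsto_add_atTop_iff_nat m).2 (tendsto_recip hq)
    rcases eq_or_ne m 0 with rfl | hm
    · simpa [cauchyTerm, recip_zero] using hrecip
    · have hpow := tendsto_pow_atTop_nhds_zero_of_norm_lt_one (norm_pow_lt_one hq hm)
      simpa [cauchyTerm, hm, pow_add, pow_mul] using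
        ((hpow.const_mul (q ^ m ^ 2)).mul_const (recip q m)).mul hrecip
  rw [← tsum_ite_eq 0 fun _ => P]
  exact tendsto_tsum_of_dominated_convergence
    (((summable_geometric_of_lt_one (norm_nonneg q) hq).mul_right C).mul_right C) hterm
    (.of_forall fun t m => norm_cauchyTerm_le hq hC t m)

lemma tsum_cauchyTerm_sub {q : A} (hq : ‖q‖ < 1) (t : ℕ) :
    ∑' m, cauchyTerm q t m - ∑' m, cauchyTerm q (t + 1) m =
      -q ^ (t + 1) * (∑' m, cauchyTerm q (t + 1) m - ∑' m, cauchyTerm q (t + 2) m) := by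
  have h0 := summable_cauchyTerm hq t
  have h1 := summable_cauchyTerm hq (t + 1)
  have h2 := summable_cauchyTerm hq (t + 2)
  have htelescope : ∑' m, (cauchyTerm q t m - cauchyTerm q (t + 1) m +
      q ^ (t + 1) * cauchyTerm q (t + 1) m) = q ^ (t + 1) * ∑' m, cauchyTerm q (t + 2) m := by
    rw [((h0.sub h1).add (h1.mul_left _)).tsum_eq_zero_add, ← h2.tsum_mul_left]
    have hz : cauchyTerm q t 0 - cauchyTerm q (t + 1) 0 +
        q ^ (t + 1) * cauchyTerm q (t + 1) 0 = 0 := by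
      simp only [cauchyTerm, zero_add, ← one_sub_pow_mul_recip_succ hq t]
      ring
    rw [hz, zero_add]
    refine tsum_congr fun m => ?_
    simp only [cauchyTerm]
    rw [show m + 1 + t = m + t + 1 by ring, show m + 1 + (t + 1) = m + t + 1 + 1 by ring,
      show m + (t + 2) = m + t + 1 + 1 by ring, ← one_sub_pow_mul_recip_succ hq m,
      ← one_sub_pow_mul_recip_succ hq (m + t + 1)]
    ring
  rw [(h0.sub h1).tsum_add (h1.mul_left _), h0.tsum_sub h1,
    h1.tsum_mul_left] at htelescope
  linear_combination htelescope

theorem tsum_cauchyTerm {q : A} (hq : ‖q‖ < 1) (t : ℕ) :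
    ∑' m, cauchyTerm q t m = Ring.inverse (qPochhammerInf q q) := by
  set D : ℕ → A := fun t => ∑' m, cauchyTerm q t m
  have hlim : Tendsto D atTop _ := tendsto_tsum_cauchyTerm hq
  have hmono : Monotone fun t => ‖D t - D (t + 1)‖ := monotone_nat_of_le_succ fun t => by
    rw [tsum_cauchyTerm_sub hq t, mul_comm]
    exact norm_mul_le_of_norm_le_one (by rw [norm_neg]; exact norm_pow_le_one hq _)
  have hlim_sub : Tendsto (fun t => ‖D t - D (t + 1)‖) atTop (𝓝 0) := by
    simpa only [sub_self, norm_zero] using (hlim.sub ((tendsto_add_atTop_iff_nat 1).2 hlim)).norm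
  have hconst (n : ℕ) : D (n + 1) = D n :=
    (sub_eq_zero.1 (norm_le_zero_iff.1 (hmono.ge_of_tendsto hlim_sub n))).symm
  have hadd (n : ℕ) : D (n + t) = D t := by
    induction n with
    | zero => rw [zero_add]
    | succ n ih => rw [add_right_comm, hconst, ih]
  refine tendsto_nhds_unique ?_ ((tendsto_add_atTop_iff_nat t).2 hlim)
  simp only [hadd]
  exact tendsto_const_nhds

/-- Jacobi's triple product identity. -/
theorem hasSum_thetaTerm {a b : A} (ha : ‖a‖ < 1) (hb : ‖b‖ < 1) :
    HasSum (thetaTerm a b) (thetaProd a b) := by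
  have hab : ‖a * b‖ < 1 := (norm_mul_le_of_norm_le_one hb.le).trans_lt ha
  have hsum_a := summable_norm_eulerTerm hab ha
  have hsum_b := summable_norm_eulerTerm hab hb
  have hpairs : HasSum (fun p : ℕ × ℕ => eulerTerm (a * b) a p.1 * eulerTerm (a * b) b p.2)
      (qPochhammerInf (-a) (a * b) * qPochhammerInf (-b) (a * b)) := by
    rw [qPochhammerInf_neg_eq_tsum hab ha, qPochhammerInf_neg_eq_tsum hab hb,
      tsum_mul_tsum_of_summable_norm hsum_a hsum_b]
    exact (summable_mul_of_summable_norm hsum_a hsum_b).hasSum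
  rw [← diffMinEquiv.symm.hasSum_iff] at hpairs
  have hfibers : HasSum
      (fun n => thetaTerm a b n * Ring.inverse (qPochhammerInf (a * b) (a * b)))
      (qPochhammerInf (-a) (a * b) * qPochhammerInf (-b) (a * b)) := by
    refine (hpairs.congr_fun fun p =>
      (eulerTerm_diffMinEquiv_symm a b p).symm).prod_fiberwise fun n => ?_
    rw [← tsum_cauchyTerm hab n.natAbs]
    exact (summable_cauchyTerm hab _).hasSum.mul_left _
  simpa only [mul_assoc, Ring.inverse_mul_cancel _ (isUnit_qPochhammerInf hab hab), mul_one,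
    thetaProd] using hfibers.mul_right (qPochhammerInf (a * b) (a * b))

end Normed

/-! ### Rogers–Szegő polynomials -/

lemma hasSum_sum_antidiagonal {M : Type*} [AddCommMonoid M] [TopologicalSpace M] [ContinuousAdd M]
    [RegularSpace M] {f : ℕ × ℕ → M} {a : M} (hf : HasSum f a) :
    HasSum (fun n => ∑ p ∈ antidiagonal n, f p) a :=
  ((HasAntidiagonal.sigmaAntidiagonalEquivProd (A := ℕ)).hasSum_iff.2 hf).sigma
    fun n => (antidiagonal n).hasSum f

section Algebra

variable {A : Type*} [CommRing A]

/-- The Rogers–Szegő polynomial `∑_{j+k=n} z^j w^k / ((q;q)_j (q;q)_k)` in two variables, normalized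
by the factor `1 / (q;q)_n`; it is the coefficient of `t^n` in `1 / ((zt;q)_∞ (wt;q)_∞)`. -/
noncomputable def rogersSzego (q z w : A) (n : ℕ) : A :=
  ∑ p ∈ antidiagonal n, z ^ p.1 * w ^ p.2 * (recip q p.1 * recip q p.2)

lemma rogersSzego_zero (q z w : A) : rogersSzego q z w 0 = 1 := by
  simp [rogersSzego, recip_zero]

lemma rogersSzego_one (q z w : A) : rogersSzego q z w 1 = (z + w) * recip q 1 := by
  rw [rogersSzego, Nat.sum_antidiagonal_succ, Nat.antidiagonal_zero, sum_singleton, recip_zero]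
  ring

lemma rogersSzego_comm (q z w : A) (n : ℕ) : rogersSzego q z w n = rogersSzego q w z n := by
  rw [rogersSzego, ← Nat.sum_antidiagonal_swap]
  exact sum_congr rfl fun p _ => by simp only [Prod.fst_swap, Prod.snd_swap]; ring

lemma rogersSzego_mul_mul (q z w c : A) (n : ℕ) :
    rogersSzego q (c * z) (c * w) n = c ^ n * rogersSzego q z w n := by
  rw [rogersSzego, rogersSzego, mul_sum]
  refine sum_congr rfl fun p hp => ?_
  rw [← mem_antidiagonal.1 hp, pow_add]
  ring

lemma coeff_rescale_mul_rescale (q z w : A) (n : ℕ) :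
    PowerSeries.coeff n (PowerSeries.rescale z (.mk (recip q)) *
      PowerSeries.rescale w (.mk (recip q))) = rogersSzego q z w n := by
  rw [PowerSeries.coeff_mul, rogersSzego]
  refine sum_congr rfl fun p _ => ?_
  simp only [PowerSeries.coeff_rescale, PowerSeries.coeff_mk]
  ring

end Algebra

section Normed

variable {A : Type*} [NormedCommRing A] [NormOneClass A] [CompleteSpace A]

lemma rescale_mk_recip {q : A} (hq : ‖q‖ < 1) (z : A) :
    PowerSeries.rescale (z * q) (.mk (recip q)) =
      (1 - PowerSeries.C z * PowerSeries.X) * PowerSeries.rescale z (.mk (recip q)) := by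
  ext n
  rw [sub_mul, one_mul, mul_assoc, map_sub, PowerSeries.coeff_C_mul]
  cases n with
  | zero => simp
  | succ n =>
    rw [PowerSeries.coeff_succ_X_mul]
    simp only [PowerSeries.coeff_rescale, PowerSeries.coeff_mk]
    rw [← one_sub_pow_mul_recip_succ hq n]
    ring

/-- The generating function `f` of the Rogers–Szegő polynomials satisfies
`f(qt) = (1 - zt)(1 - wt) f(t)`. -/
lemma rogersSzego_succ_succ {q : A} (hq : ‖q‖ < 1) (z w : A) (n : ℕ) :
    (1 - q ^ (n + 2)) * rogersSzego q z w (n + 2) =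
      (z + w) * rogersSzego q z w (n + 1) - z * w * rogersSzego q z w n := by
  have hgen : PowerSeries.rescale (z * q) (.mk (recip q)) *
      PowerSeries.rescale (w * q) (.mk (recip q)) =
      (1 - PowerSeries.C (z + w) * PowerSeries.X + PowerSeries.C (z * w) * PowerSeries.X ^ 2) *
        (PowerSeries.rescale z (.mk (recip q)) * PowerSeries.rescale w (.mk (recip q))) := by
    rw [rescale_mk_recip hq, rescale_mk_recip hq, map_add, map_mul]
    ring
  have hcoeff := congrArg (PowerSeries.coeff (n + 2)) hgen
  rw [coeff_rescale_mul_rescale, mul_comm z q, mul_comm w q, rogersSzego_mul_mul, add_mul, sub_mul,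
    one_mul, mul_assoc, mul_assoc, map_add, map_sub, PowerSeries.coeff_C_mul,
    PowerSeries.coeff_C_mul, PowerSeries.coeff_succ_X_mul, PowerSeries.coeff_X_pow_mul] at hcoeff
  simp only [coeff_rescale_mul_rescale] at hcoeff
  linear_combination -hcoeff

lemma eq_of_one_sub_pow_mul_eq {q a b : A} (hq : ‖q‖ < 1) {n : ℕ} (hn : n ≠ 0)
    (h : (1 - q ^ n) * a = (1 - q ^ n) * b) : a = b :=
  (isUnit_one_sub_of_norm_lt_one (norm_pow_lt_one hq hn)).mul_left_cancel h

lemma rogersSzego_sq_one_self {q : A} (hq : ‖q‖ < 1) (n : ℕ) :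
    rogersSzego (q ^ 2) 1 q n = recip q n := by
  have hq2 : ‖q ^ 2‖ < 1 := norm_pow_lt_one hq two_ne_zero
  induction n using Nat.twoStepInduction with
  | zero => rw [rogersSzego_zero, recip_zero]
  | one =>
    refine eq_of_one_sub_pow_mul_eq hq2 one_ne_zero ?_
    have hq1 := one_sub_pow_mul_recip_succ hq 0
    have hq21 := one_sub_pow_mul_recip_succ hq2 0
    rw [rogersSzego_one]
    rw [recip_zero] at hq1 hq21
    linear_combination (1 + q) * (hq21 - hq1)
  | more n ih₀ ih₁ =>
    refine eq_of_one_sub_pow_mul_eq hq2 (n := n + 2) (by lia) ?_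
    rw [rogersSzego_succ_succ hq2, ih₀, ih₁]
    linear_combination q * one_sub_pow_mul_recip_succ hq n -
      (1 + q ^ (n + 2)) * one_sub_pow_mul_recip_succ hq (n + 1)

lemma rogersSzego_one_neg_one_odd {q : A} (hq : ‖q‖ < 1) (n : ℕ) :
    rogersSzego q 1 (-1) (2 * n + 1) = 0 := by
  induction n with
  | zero => rw [mul_zero, zero_add, rogersSzego_one, add_neg_cancel, zero_mul]
  | succ n ih =>
    refine eq_of_one_sub_pow_mul_eq hq (n := 2 * n + 3) (by lia) ?_
    rw [show 2 * (n + 1) + 1 = 2 * n + 1 + 2 by ring, rogersSzego_succ_succ hq, ih]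
    ring

lemma rogersSzego_one_neg_one_even {q : A} (hq : ‖q‖ < 1) (n : ℕ) :
    rogersSzego q 1 (-1) (2 * n) = recip (q ^ 2) n := by
  induction n with
  | zero => rw [mul_zero, rogersSzego_zero, recip_zero]
  | succ n ih =>
    refine eq_of_one_sub_pow_mul_eq hq (n := 2 * n + 2) (by lia) ?_
    rw [mul_add_one, rogersSzego_succ_succ hq, ih]
    linear_combination -one_sub_pow_mul_recip_succ (norm_pow_lt_one hq two_ne_zero) n

lemma summable_pow_mul_recip_mul_recip {q z w : A} (hq : ‖q‖ < 1) (hz : ‖z‖ ≤ 1) (hw : ‖w‖ ≤ 1) :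
    Summable fun p : ℕ × ℕ => q ^ (p.1 + p.2) ^ 2 *
      (z ^ p.1 * w ^ p.2 * (recip (q ^ 2) p.1 * recip (q ^ 2) p.2)) := by
  obtain ⟨C, hC⟩ := exists_norm_recip_le (norm_pow_lt_one hq two_ne_zero)
  have hgeom := summable_geometric_of_lt_one (norm_nonneg q) hq
  refine .of_norm_bounded ((hgeom.mul_of_nonneg hgeom (fun _ => by positivity)
    fun _ => by positivity).mul_right (C * C)) fun p => (norm_mul_le _ _).trans ?_
  have hC0 : 0 ≤ C := (norm_nonneg _).trans (hC 0)
  have hzw : ‖z ^ p.1 * w ^ p.2‖ ≤ 1 :=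
    (norm_mul_le _ _).trans (mul_le_one₀ ((norm_pow_le z _).trans (pow_le_one₀ (norm_nonneg z) hz))
      (norm_nonneg _) ((norm_pow_le w _).trans (pow_le_one₀ (norm_nonneg w) hw)))
  rw [← pow_add, mul_comm (z ^ p.1 * w ^ p.2)]
  gcongr
  · exact norm_pow_le_pow_of_le hq (Nat.le_self_pow two_ne_zero _)
  · refine (norm_mul_le_of_norm_le_one hzw).trans ((norm_mul_le _ _).trans ?_)
    gcongr <;> exact hC _

/-- Expanding the infinite product by Euler turns the left-hand side into a double series with
general term `q^{(n+k)²} z^n w^k / ((q²;q²)_n (q²;q²)_k)`. -/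
theorem tsum_mul_qPochhammerInf_eq {q z w : A} (hq : ‖q‖ < 1) (hz : ‖z‖ ≤ 1) (hw : ‖w‖ ≤ 1) :
    ∑' n, q ^ n ^ 2 * z ^ n * (recip (q ^ 2) n * qPochhammerInf (-(w * q ^ (2 * n + 1))) (q ^ 2)) =
      ∑' n, q ^ n ^ 2 * rogersSzego (q ^ 2) z w n := by
  have hq2 : ‖q ^ 2‖ < 1 := norm_pow_lt_one hq two_ne_zero
  have hsum := summable_pow_mul_recip_mul_recip hq hz hw
  have hterm (n k : ℕ) : q ^ n ^ 2 * z ^ n * recip (q ^ 2) n *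
      eulerTerm (q ^ 2) (w * q ^ (2 * n + 1)) k = q ^ (n + k) ^ 2 *
        (z ^ n * w ^ k * (recip (q ^ 2) n * recip (q ^ 2) k)) := by
    rw [add_sq, sq_eq_two_mul_choose_two_add k, eulerTerm]
    ring
  have hfiber (n : ℕ) : ∑' k, q ^ (n + k) ^ 2 *
      (z ^ n * w ^ k * (recip (q ^ 2) n * recip (q ^ 2) k)) = q ^ n ^ 2 * z ^ n *
        (recip (q ^ 2) n * qPochhammerInf (-(w * q ^ (2 * n + 1))) (q ^ 2)) := by
    have hwq : ‖w * q ^ (2 * n + 1)‖ < 1 := by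
      rw [mul_comm]
      exact (norm_mul_le_of_norm_le_one hw).trans_lt (norm_pow_lt_one hq (2 * n).succ_ne_zero)
    rw [qPochhammerInf_neg_eq_tsum hq2 hwq, ← mul_assoc,
      ← (summable_norm_eulerTerm hq2 hwq).of_norm.tsum_mul_left]
    exact tsum_congr fun k => (hterm n k).symm
  rw [← tsum_congr hfiber, ← hsum.tsum_prod, ← (hasSum_sum_antidiagonal hsum.hasSum).tsum_eq]
  refine tsum_congr fun n => ?_
  rw [rogersSzego, mul_sum]
  exact sum_congr rfl fun p hp => by rw [mem_antidiagonal.1 hp]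

lemma recip_mul_qPochhammerInf_neg {q : A} (hq : ‖q‖ < 1) (n : ℕ) :
    recip (q ^ 2) n * qPochhammerInf (-q) q = recip q n * qPochhammerInf (-(q * q ^ n)) q := by
  have hrecip := qPochhammer_mul_recip (norm_pow_lt_one hq two_ne_zero) n
  rw [← qPochhammer_mul_neg] at hrecip
  rw [qPochhammerInf_eq_qPochhammer_mul hq (-q) n, ← neg_mul]
  linear_combination recip q n * qPochhammerInf (-q * q ^ n) q * hrecip -
    recip (q ^ 2) n * qPochhammer (-q) q n * qPochhammerInf (-q * q ^ n) q *
      qPochhammer_mul_recip hq n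

lemma recip_two_mul_mul_qPochhammerInf {q : A} (hq : ‖q‖ < 1) (n : ℕ) :
    recip q (2 * n) * qPochhammerInf q (q ^ 2) =
      recip (q ^ 2) n * qPochhammerInf (q ^ (2 * n + 1)) (q ^ 2) := by
  have hq2 : ‖q ^ 2‖ < 1 := norm_pow_lt_one hq two_ne_zero
  have hrecip := qPochhammer_mul_recip hq (2 * n)
  rw [qPochhammer_mul_eq_prod, prod_range_succ, prod_range_one, pow_zero, mul_one, pow_one,
    ← sq] at hrecip
  rw [qPochhammerInf_eq_qPochhammer_mul hq2 q n, ← pow_mul, ← pow_succ']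
  linear_combination recip (q ^ 2) n * qPochhammerInf (q ^ (2 * n + 1)) (q ^ 2) * hrecip -
    recip q (2 * n) * qPochhammer q (q ^ 2) n * qPochhammerInf (q ^ (2 * n + 1)) (q ^ 2) *
      qPochhammer_mul_recip hq2 n

lemma recip_two_mul_add_one_mul_qPochhammerInf {q : A} (hq : ‖q‖ < 1) (n : ℕ) :
    recip q (2 * n + 1) * qPochhammerInf q (q ^ 2) =
      recip (q ^ 2) n * qPochhammerInf (q ^ (2 * n + 3)) (q ^ 2) := by
  refine eq_of_one_sub_pow_mul_eq hq (2 * n).succ_ne_zero ?_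
  rw [Nat.succ_eq_add_one, ← mul_assoc, one_sub_pow_mul_recip_succ hq,
    recip_two_mul_mul_qPochhammerInf hq,
    qPochhammerInf_eq_one_sub_mul (norm_pow_lt_one hq two_ne_zero), ← pow_add]
  ring

lemma tsum_mul_eq_tsum_rogersSzego {q w P : A} (hq : ‖q‖ < 1) (hw : ‖w‖ ≤ 1) {f : ℕ → ℕ} {c : ℕ}
    (hf : ∀ n, f n = n ^ 2 + c * n) {r : ℕ → A} (hsum : Summable fun n => q ^ f n * r n)
    (hr : ∀ n, r n * P = recip (q ^ 2) n * qPochhammerInf (-(w * q ^ (2 * n + 1))) (q ^ 2)) :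
    (∑' n, q ^ f n * r n) * P = ∑' n, q ^ n ^ 2 * rogersSzego (q ^ 2) (q ^ c) w n := by
  rw [← tsum_mul_qPochhammerInf_eq hq (norm_pow_le_one hq c) hw, ← hsum.tsum_mul_right]
  refine tsum_congr fun n => ?_
  rw [mul_assoc, hr, hf, pow_add, pow_mul]

lemma tsum_mul_recip_sq_sq {q : A} (hq : ‖q‖ < 1) {f : ℕ → ℕ} {c : ℕ}
    (hf : ∀ n, f n = n ^ 2 + c * n) :
    (∑' n, q ^ f n * recip (q ^ 4) n) * qPochhammerInf (-q ^ 2) (q ^ 2) =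
      ∑' n, q ^ n ^ 2 * rogersSzego (q ^ 2) (q ^ c) q n := by
  refine tsum_mul_eq_tsum_rogersSzego hq hq.le hf
    (summable_pow_mul_recip hq (norm_pow_lt_one hq four_ne_zero) fun n => ?_) fun n => ?_
  · nlinarith [hf n]
  · rw [show q ^ 4 = (q ^ 2) ^ 2 by ring, recip_mul_qPochhammerInf_neg
      (norm_pow_lt_one hq two_ne_zero)]
    ring_nf

lemma tsum_mul_recip_even {q : A} (hq : ‖q‖ < 1) {f : ℕ → ℕ} {c : ℕ}
    (hf : ∀ n, f n = n ^ 2 + c * n) :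
    (∑' n, q ^ f n * recip q (2 * n)) * qPochhammerInf q (q ^ 2) =
      ∑' n, q ^ n ^ 2 * rogersSzego (q ^ 2) (q ^ c) (-1) n := by
  refine tsum_mul_eq_tsum_rogersSzego hq (by rw [norm_neg, norm_one]) hf
    (summable_pow_mul_recip hq hq fun n => ?_) fun n => ?_
  · nlinarith [hf n]
  · rw [recip_two_mul_mul_qPochhammerInf hq, neg_mul, one_mul, neg_neg]

lemma tsum_mul_recip_odd {q : A} (hq : ‖q‖ < 1) {f : ℕ → ℕ} {c : ℕ}
    (hf : ∀ n, f n = n ^ 2 + c * n) :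
    (∑' n, q ^ f n * recip q (2 * n + 1)) * qPochhammerInf q (q ^ 2) =
      ∑' n, q ^ n ^ 2 * rogersSzego (q ^ 2) (q ^ c) (-q ^ 2) n := by
  refine tsum_mul_eq_tsum_rogersSzego hq (by rw [norm_neg]; exact norm_pow_le_one hq 2) hf
    (summable_pow_mul_recip hq hq fun n => ?_) fun n => ?_
  · nlinarith [hf n]
  · rw [recip_two_mul_add_one_mul_qPochhammerInf hq, neg_mul, neg_neg, ← pow_add,
      show 2 + (2 * n + 1) = 2 * n + 3 by ring]

lemma tsum_rogersSzego_pow_neg_pow {q : A} (hq : ‖q‖ < 1) (c : ℕ) :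
    ∑' n, q ^ n ^ 2 * rogersSzego (q ^ 2) (q ^ c) (-q ^ c) n =
      ∑' n, q ^ (4 * n ^ 2 + 2 * c * n) * recip (q ^ 4) n := by
  have hq2 : ‖q ^ 2‖ < 1 := norm_pow_lt_one hq two_ne_zero
  have hscale (n : ℕ) : rogersSzego (q ^ 2) (q ^ c) (-q ^ c) n =
      (q ^ c) ^ n * rogersSzego (q ^ 2) 1 (-1) n := by
    rw [← rogersSzego_mul_mul, mul_one, mul_neg_one]
  simp only [hscale]
  rw [← (mul_right_injective₀ (two_ne_zero' ℕ)).tsum_eq]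
  · refine tsum_congr fun n => ?_
    rw [rogersSzego_one_neg_one_even hq2]
    ring_nf
  · refine Function.support_subset_iff'.2 fun n hn => ?_
    obtain ⟨m, rfl⟩ := Nat.not_even_iff_odd.1 fun h => hn ⟨n / 2, Nat.two_mul_div_two_of_even h⟩
    rw [rogersSzego_one_neg_one_odd hq2, mul_zero, mul_zero]

lemma tsum_sq_mul_recip {q : A} (hq : ‖q‖ < 1) :
    (∑' n, q ^ n ^ 2 * recip (q ^ 4) n) * qPochhammerInf (-q ^ 2) (q ^ 2) = sumG q := by
  rw [tsum_mul_recip_sq_sq hq (c := 0) fun n => by ring, pow_zero]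
  exact tsum_congr fun n => by rw [rogersSzego_sq_one_self hq, sumTermG, recip]

lemma tsum_sq_add_two_mul_mul_recip {q : A} (hq : ‖q‖ < 1) :
    (∑' n, q ^ (n ^ 2 + 2 * n) * recip (q ^ 4) n) * qPochhammerInf (-q ^ 2) (q ^ 2) = sumH q := by
  have hscale (n : ℕ) : rogersSzego (q ^ 2) (q ^ 2) q n = q ^ n * recip q n := by
    rw [← rogersSzego_sq_one_self hq, rogersSzego_comm, ← rogersSzego_mul_mul, mul_one, sq,
      rogersSzego_comm]
  rw [tsum_mul_recip_sq_sq hq fun n => rfl]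
  refine tsum_congr fun n => ?_
  rw [hscale, sumTermH, ← recip, ← mul_assoc, ← pow_add]
  ring_nf

lemma tsum_sq_mul_recip_even {q : A} (hq : ‖q‖ < 1) :
    (∑' n, q ^ n ^ 2 * recip q (2 * n)) * qPochhammerInf q (q ^ 2) = sumG (q ^ 4) := by
  have hsum := tsum_rogersSzego_pow_neg_pow hq 0
  rw [pow_zero] at hsum
  rw [tsum_mul_recip_even hq (c := 0) fun n => by ring, pow_zero, hsum]
  exact tsum_congr fun n => by rw [sumTermG, recip, ← pow_mul]; ring_nf

lemma tsum_sq_add_self_mul_recip_even {q : A} (hq : ‖q‖ < 1) :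
    (∑' n, q ^ (n ^ 2 + n) * recip q (2 * n)) * qPochhammerInf q (q ^ 2) = sumG (-q) := by
  have hscale (n : ℕ) : rogersSzego (q ^ 2) q (-1) n = (-1) ^ n * recip (-q) n := by
    rw [← rogersSzego_sq_one_self (by rwa [norm_neg]), rogersSzego_comm (_ ^ 2) 1,
      ← rogersSzego_mul_mul, neg_mul_neg, one_mul, mul_one, neg_sq]
  rw [tsum_mul_recip_even hq (c := 1) fun n => by ring, pow_one]
  refine tsum_congr fun n => ?_
  rw [hscale, sumTermG, ← recip, neg_pow q, neg_one_pow_congr (Nat.even_pow' two_ne_zero)]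
  ring

lemma tsum_sq_add_self_mul_recip_odd {q : A} (hq : ‖q‖ < 1) :
    (∑' n, q ^ (n ^ 2 + n) * recip q (2 * n + 1)) * qPochhammerInf q (q ^ 2) = sumH (-q) := by
  have hscale (n : ℕ) : rogersSzego (q ^ 2) q (-q ^ 2) n = q ^ n * recip (-q) n := by
    rw [← rogersSzego_sq_one_self (by rwa [norm_neg]), ← rogersSzego_mul_mul, mul_neg, mul_one,
      ← sq, neg_sq]
  rw [tsum_mul_recip_odd hq (c := 1) fun n => by ring, pow_one]
  refine tsum_congr fun n => ?_
  rw [hscale, sumTermH, ← recip, (Nat.even_mul_succ_self n).neg_pow]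
  ring

lemma tsum_sq_add_two_mul_mul_recip_odd {q : A} (hq : ‖q‖ < 1) :
    (∑' n, q ^ (n ^ 2 + 2 * n) * recip q (2 * n + 1)) * qPochhammerInf q (q ^ 2) =
      sumH (q ^ 4) := by
  rw [tsum_mul_recip_odd hq fun n => rfl, tsum_rogersSzego_pow_neg_pow hq]
  exact tsum_congr fun n => by rw [sumTermH, recip, ← pow_mul]; ring_nf

end Normed

/-! ### Rogers' equations for the sums -/

section Normed

variable {A : Type*} [NormedCommRing A] [NormOneClass A] [CompleteSpace A]

lemma F_mul_qPochhammerInf_sq {q : A} (hq : ‖q‖ < 1) :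
    F q * qPochhammerInf (q ^ 4) ((q ^ 4) ^ 2) = qPochhammerInf (-q ^ 2) (q ^ 2) := by
  have hq2 : ‖q ^ 2‖ < 1 := norm_pow_lt_one hq two_ne_zero
  have hq4 : ‖q ^ 4‖ < 1 := norm_pow_lt_one hq four_ne_zero
  have heven_odd := qPochhammerInf_eq_mul hq4 (q ^ 4)
  have hneg := qPochhammerInf_mul_neg hq2 (q ^ 2)
  rw [show q ^ 4 * q ^ 4 = q ^ 8 by ring, show (q ^ 4) ^ 2 = q ^ 8 by ring] at heven_odd
  rw [show (q ^ 2) ^ 2 = q ^ 4 by ring, heven_odd] at hneg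
  rw [show (q ^ 4) ^ 2 = q ^ 8 by ring]
  refine (isUnit_qPochhammerInf hq2 hq2).mul_left_cancel ?_
  linear_combination qPochhammerInf (q ^ 4) (q ^ 8) * F_mul_qPochhammerInf hq - hneg

lemma eq_F_mul_of_dissection {q : A} (hq : ‖q‖ < 1) {f : ℕ → ℕ} (hf : ∀ n, n ≤ f n) {x y z : A}
    (hx : (∑' n, q ^ f n * recip (q ^ 4) n) * qPochhammerInf (-q ^ 2) (q ^ 2) = x)
    (hy : (∑' n, q ^ f (2 * n) * recip (q ^ 4) (2 * n)) *
      qPochhammerInf (q ^ 4) ((q ^ 4) ^ 2) = y)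
    (hz : (∑' n, q ^ f (2 * n + 1) * recip (q ^ 4) (2 * n + 1)) *
      qPochhammerInf (q ^ 4) ((q ^ 4) ^ 2) = z) :
    x = F q * (y + z) := by
  have hsum := summable_pow_mul_recip hq (norm_pow_lt_one hq four_ne_zero) hf (g := id)
  rw [← hx, ← hy, ← hz, ← F_mul_qPochhammerInf_sq hq,
    ← tsum_even_add_odd (f := fun n => q ^ f n * recip (q ^ 4) n)
      (hsum.comp_injective (mul_right_injective₀ two_ne_zero))
      (hsum.comp_injective ((add_left_injective 1).comp (mul_right_injective₀ two_ne_zero)))]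
  ring

theorem sumG_eq_F_mul {q : A} (hq : ‖q‖ < 1) :
    sumG q = F q * (sumG (q ^ 16) + q * sumH (-q ^ 4)) := by
  have hq4 : ‖q ^ 4‖ < 1 := norm_pow_lt_one hq four_ne_zero
  refine eq_F_mul_of_dissection hq (Nat.le_self_pow two_ne_zero) (tsum_sq_mul_recip hq) ?_ ?_
  · rw [show q ^ 16 = (q ^ 4) ^ 4 by ring, ← tsum_sq_mul_recip_even hq4]
    ring_nf
  · rw [← tsum_sq_add_self_mul_recip_odd hq4, ← mul_assoc,
      ← (summable_pow_mul_recip hq4 hq4 fun n => Nat.le_add_left n _).tsum_mul_left]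
    ring_nf

theorem sumH_eq_F_mul {q : A} (hq : ‖q‖ < 1) :
    sumH q = F q * (sumG (-q ^ 4) + q ^ 3 * sumH (q ^ 16)) := by
  have hq4 : ‖q ^ 4‖ < 1 := norm_pow_lt_one hq four_ne_zero
  refine eq_F_mul_of_dissection hq (fun n => by lia) (tsum_sq_add_two_mul_mul_recip hq) ?_ ?_
  · rw [← tsum_sq_add_self_mul_recip_even hq4]
    ring_nf
  · rw [show q ^ 16 = (q ^ 4) ^ 4 by ring, ← tsum_sq_add_two_mul_mul_recip_odd hq4, ← mul_assoc,
      ← (summable_pow_mul_recip hq4 hq4 fun n => by lia).tsum_mul_left]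
    ring_nf

end Normed

/-! ### Rogers' equations for the products -/

section Algebra

variable {A : Type*} [CommRing A] [TopologicalSpace A]

omit [TopologicalSpace A] in
lemma mul_eq_mul_of_mul_eq_one {x d s t c : A} (hx : x * d = 1) (h : s * d * t = c) :
    x * c = s * t := by
  linear_combination s * t * hx - x * h

lemma thetaProd_comm (a b : A) : thetaProd a b = thetaProd b a := by
  rw [thetaProd, thetaProd, mul_comm b a, mul_comm (qPochhammerInf (-b) _)]

lemma denG_pow_four (q : A) :
    denG (q ^ 4) = qPochhammerInf (q ^ 4) (q ^ 20) * qPochhammerInf (q ^ 16) (q ^ 20) := by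
  rw [denG, ← pow_mul, ← pow_mul]

lemma denH_pow_four (q : A) :
    denH (q ^ 4) = qPochhammerInf (q ^ 8) (q ^ 20) * qPochhammerInf (q ^ 12) (q ^ 20) := by
  rw [denH, ← pow_mul, ← pow_mul, ← pow_mul]

lemma thetaProd_pow_pow (q : A) (m n : ℕ) :
    thetaProd (q ^ m) (q ^ n) = qPochhammerInf (-q ^ m) (q ^ (m + n)) *
      qPochhammerInf (-q ^ n) (q ^ (m + n)) * qPochhammerInf (q ^ (m + n)) (q ^ (m + n)) := by
  rw [thetaProd, ← pow_add]

end Algebra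

section Normed

variable {A : Type*} [NormedCommRing A] [NormOneClass A] [CompleteSpace A]

omit [NormOneClass A] [CompleteSpace A] in
lemma hasSum_int_even_add_odd {f : ℤ → A} {x y : A} (hx : HasSum (fun n => f (2 * n)) x)
    (hy : HasSum (fun n => f (2 * n + 1)) y) : HasSum f (x + y) := by
  have hdouble : Function.Injective fun n : ℤ => 2 * n := mul_right_injective₀ two_ne_zero
  refine HasSum.add_isCompl ?_ (hdouble.hasSum_range_iff.mpr hx)
    (((add_left_injective 1).comp hdouble).hasSum_range_iff.mpr hy)
  simpa [Function.comp_def] using Int.isCompl_even_odd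

/-- The terms of even and of odd index of the theta series again form theta series. -/
theorem thetaProd_mul_eq_add {a c : A} (ha : ‖a‖ < 1) (hc : ‖c‖ < 1) :
    thetaProd a (a * c) =
      thetaProd (a ^ 4 * c) (a ^ 4 * c ^ 3) + a * thetaProd (a ^ 8 * c ^ 3) c := by
  have hpow_mul {x : A} (hx : ‖x‖ < 1) (k : ℕ) : ‖a ^ k * x‖ < 1 := by
    rw [mul_comm]
    exact norm_mul_pow_lt_one hx ha k
  have hac : ‖a * c‖ < 1 := by simpa only [pow_one] using hpow_mul hc 1
  have hc3 : ‖c ^ 3‖ < 1 := norm_pow_lt_one hc three_ne_zero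
  refine (hasSum_thetaTerm ha hac).unique (hasSum_int_even_add_odd
    ((hasSum_thetaTerm (hpow_mul hc 4) (hpow_mul hc3 4)).congr_fun fun n => ?_)
    (((hasSum_thetaTerm (hpow_mul hc3 8) hc).mul_left a).congr_fun fun n => ?_))
  · have h₁ := two_mul_tri n
    have h₂ := two_mul_tri (-n)
    have h₃ := two_mul_tri (2 * n)
    have h₄ := two_mul_tri (-(2 * n))
    have hexp_c : tri (-(2 * n)) = tri n + 3 * tri (-n) := by zify; linarith
    have hexp_a : tri (2 * n) + tri (-(2 * n)) = 4 * tri n + 4 * tri (-n) := by zify; linarith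
    calc thetaTerm a (a * c) (2 * n)
        = a ^ (tri (2 * n) + tri (-(2 * n))) * c ^ tri (-(2 * n)) := by
          rw [thetaTerm]; ring
      _ = thetaTerm (a ^ 4 * c) (a ^ 4 * c ^ 3) n := by rw [hexp_a, hexp_c, thetaTerm]; ring
  · have h₁ := two_mul_tri n
    have h₂ := two_mul_tri (-n)
    have h₃ := two_mul_tri (2 * n + 1)
    have h₄ := two_mul_tri (-(2 * n + 1))
    have hexp_c : tri (-(2 * n + 1)) = 3 * tri n + tri (-n) := by zify; linarith
    have hexp_a : tri (2 * n + 1) + tri (-(2 * n + 1)) = 1 + 8 * tri n := by zify; linarith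
    calc thetaTerm a (a * c) (2 * n + 1)
        = a ^ (tri (2 * n + 1) + tri (-(2 * n + 1))) * c ^ tri (-(2 * n + 1)) := by
          rw [thetaTerm]; ring
      _ = a * thetaTerm (a ^ 8 * c ^ 3) c n := by rw [hexp_a, hexp_c, thetaTerm]; ring

lemma qPochhammerInf_pow_eq_mul_pow_ten {q : A} (hq : ‖q‖ < 1) (m : ℕ) :
    qPochhammerInf (q ^ m) (q ^ 5) =
      qPochhammerInf (q ^ m) (q ^ 10) * qPochhammerInf (q ^ (m + 5)) (q ^ 10) := by
  rw [qPochhammerInf_eq_mul (norm_pow_lt_one hq (by norm_num)), ← pow_add, ← pow_mul]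

lemma qPochhammerInf_pow_eq_mul_pow_twenty {q : A} (hq : ‖q‖ < 1) (m : ℕ) :
    qPochhammerInf (q ^ m) (q ^ 10) =
      qPochhammerInf (q ^ m) (q ^ 20) * qPochhammerInf (q ^ (m + 10)) (q ^ 20) := by
  rw [qPochhammerInf_eq_mul (norm_pow_lt_one hq (by norm_num)), ← pow_add, ← pow_mul]

lemma qPochhammerInf_pow_mul_neg {q : A} (hq : ‖q‖ < 1) (m : ℕ) :
    qPochhammerInf (q ^ m) (q ^ 10) * qPochhammerInf (-q ^ m) (q ^ 10) =
      qPochhammerInf (q ^ (m * 2)) (q ^ 20) := by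
  rw [qPochhammerInf_mul_neg (norm_pow_lt_one hq (by norm_num)), ← pow_mul, ← pow_mul]

lemma qPochhammerInf_sq_sq {q : A} (hq : ‖q‖ < 1) :
    qPochhammerInf (q ^ 2) (q ^ 2) = qPochhammerInf (q ^ 2) (q ^ 10) *
      qPochhammerInf (q ^ 4) (q ^ 10) * qPochhammerInf (q ^ 6) (q ^ 10) *
      qPochhammerInf (q ^ 8) (q ^ 10) * qPochhammerInf (q ^ 10) (q ^ 10) := by
  rw [qPochhammerInf_eq_prod (norm_pow_lt_one hq two_ne_zero) _ (show 5 ≠ 0 by norm_num)]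
  simp only [prod_range_succ, prod_range_zero, one_mul, ← pow_mul, ← pow_add]

lemma denG_eq {q : A} (hq : ‖q‖ < 1) :
    denG q = qPochhammerInf q (q ^ 10) * qPochhammerInf (q ^ 6) (q ^ 10) *
      (qPochhammerInf (q ^ 4) (q ^ 10) * qPochhammerInf (q ^ 9) (q ^ 10)) := by
  have hone := qPochhammerInf_pow_eq_mul_pow_ten hq 1
  rw [pow_one] at hone
  rw [denG, hone, qPochhammerInf_pow_eq_mul_pow_ten hq 4]

lemma denH_eq {q : A} (hq : ‖q‖ < 1) :
    denH q = qPochhammerInf (q ^ 2) (q ^ 10) * qPochhammerInf (q ^ 7) (q ^ 10) *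
      (qPochhammerInf (q ^ 3) (q ^ 10) * qPochhammerInf (q ^ 8) (q ^ 10)) := by
  rw [denH, qPochhammerInf_pow_eq_mul_pow_ten hq 2, qPochhammerInf_pow_eq_mul_pow_ten hq 3]

lemma denG_neg {q : A} (hq : ‖q‖ < 1) :
    denG (-q) = qPochhammerInf (-q) (q ^ 10) * qPochhammerInf (q ^ 6) (q ^ 10) *
      (qPochhammerInf (q ^ 4) (q ^ 10) * qPochhammerInf (-q ^ 9) (q ^ 10)) := by
  have hneg : ‖(-q) ^ 5‖ < 1 := norm_pow_lt_one (by rwa [norm_neg]) (by norm_num)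
  rw [denG, qPochhammerInf_eq_mul hneg, qPochhammerInf_eq_mul hneg]
  ring_nf

lemma denH_neg {q : A} (hq : ‖q‖ < 1) :
    denH (-q) = qPochhammerInf (q ^ 2) (q ^ 10) * qPochhammerInf (-q ^ 7) (q ^ 10) *
      (qPochhammerInf (-q ^ 3) (q ^ 10) * qPochhammerInf (q ^ 8) (q ^ 10)) := by
  have hneg : ‖(-q) ^ 5‖ < 1 := norm_pow_lt_one (by rwa [norm_neg]) (by norm_num)
  rw [denH, qPochhammerInf_eq_mul hneg, qPochhammerInf_eq_mul hneg]
  ring_nf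

lemma thetaProd_mul_denG_mul_denH {q : A} (hq : ‖q‖ < 1) :
    thetaProd q (q ^ 9) * denG q * denH (q ^ 4) = qPochhammerInf (q ^ 2) (q ^ 2) := by
  have htheta := thetaProd_pow_pow q 1 9
  have hneg₁ := qPochhammerInf_pow_mul_neg hq 1
  have hneg₉ := qPochhammerInf_pow_mul_neg hq 9
  have hsplit₂ := qPochhammerInf_pow_eq_mul_pow_twenty hq 2
  have hsplit₈ := qPochhammerInf_pow_eq_mul_pow_twenty hq 8
  norm_num at htheta hneg₁ hneg₉ hsplit₂ hsplit₈
  rw [htheta, denG_eq hq, denH_pow_four, qPochhammerInf_sq_sq hq, hsplit₂, hsplit₈, ← hneg₁,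
    ← hneg₉]
  ring

lemma thetaProd_mul_denH_mul_denG {q : A} (hq : ‖q‖ < 1) :
    thetaProd (q ^ 3) (q ^ 7) * denH q * denG (q ^ 4) = qPochhammerInf (q ^ 2) (q ^ 2) := by
  rw [thetaProd_pow_pow, denH_eq hq, denG_pow_four, qPochhammerInf_sq_sq hq,
    qPochhammerInf_pow_eq_mul_pow_twenty hq 4, qPochhammerInf_pow_eq_mul_pow_twenty hq 6,
    ← qPochhammerInf_pow_mul_neg hq 3, ← qPochhammerInf_pow_mul_neg hq 7]
  ring

lemma thetaProd_mul_denH_mul_denH_neg {q : A} (hq : ‖q‖ < 1) :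
    thetaProd (q ^ 2) (q ^ 8) * denH q * denH (-q) = qPochhammerInf (q ^ 2) (q ^ 2) := by
  rw [thetaProd_pow_pow, denH_eq hq, denH_neg hq, qPochhammerInf_sq_sq hq,
    qPochhammerInf_pow_eq_mul_pow_twenty hq 4, qPochhammerInf_pow_eq_mul_pow_twenty hq 6,
    ← qPochhammerInf_pow_mul_neg hq 2, ← qPochhammerInf_pow_mul_neg hq 3,
    ← qPochhammerInf_pow_mul_neg hq 7, ← qPochhammerInf_pow_mul_neg hq 8]
  ring

lemma thetaProd_mul_denG_mul_denG_neg {q : A} (hq : ‖q‖ < 1) :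
    thetaProd (q ^ 4) (q ^ 6) * denG q * denG (-q) = qPochhammerInf (q ^ 2) (q ^ 2) := by
  have hneg₁ := qPochhammerInf_pow_mul_neg hq 1
  have hneg₉ := qPochhammerInf_pow_mul_neg hq 9
  have hsplit₂ := qPochhammerInf_pow_eq_mul_pow_twenty hq 2
  have hsplit₈ := qPochhammerInf_pow_eq_mul_pow_twenty hq 8
  norm_num at hneg₁ hneg₉ hsplit₂ hsplit₈
  rw [thetaProd_pow_pow, denG_eq hq, denG_neg hq, qPochhammerInf_sq_sq hq, hsplit₂, hsplit₈,
    ← hneg₁, ← hneg₉, ← qPochhammerInf_pow_mul_neg hq 4, ← qPochhammerInf_pow_mul_neg hq 6]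
  ring

lemma thetaProd_one_nine {q : A} (hq : ‖q‖ < 1) :
    thetaProd q (q ^ 9) =
      thetaProd ((q ^ 4) ^ 3) ((q ^ 4) ^ 7) + q * thetaProd ((q ^ 4) ^ 2) ((q ^ 4) ^ 8) := by
  have hsplit := thetaProd_mul_eq_add hq (norm_pow_lt_one hq (by norm_num : 8 ≠ 0))
  rw [thetaProd_comm _ (q ^ 8)] at hsplit
  ring_nf at hsplit ⊢
  exact hsplit

lemma thetaProd_three_seven {q : A} (hq : ‖q‖ < 1) :
    thetaProd (q ^ 3) (q ^ 7) =
      thetaProd ((q ^ 4) ^ 4) ((q ^ 4) ^ 6) + q ^ 3 * thetaProd (q ^ 4) ((q ^ 4) ^ 9) := by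
  have hsplit := thetaProd_mul_eq_add (norm_pow_lt_one hq three_ne_zero)
    (norm_pow_lt_one hq four_ne_zero)
  rw [thetaProd_comm _ (q ^ 4)] at hsplit
  ring_nf at hsplit ⊢
  exact hsplit

theorem prodG_eq_F_mul {q : A} (hq : ‖q‖ < 1) :
    prodG q = F q * (prodG (q ^ 16) + q * prodH (-q ^ 4)) := by
  have hq2 : ‖q ^ 2‖ < 1 := norm_pow_lt_one hq two_ne_zero
  have hq4 : ‖q ^ 4‖ < 1 := norm_pow_lt_one hq four_ne_zero
  have hG := mul_eq_mul_of_mul_eq_one (prodG_mul_denG hq) (thetaProd_mul_denG_mul_denH hq)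
  have hG_pow := mul_eq_mul_of_mul_eq_one (prodG_mul_denG (norm_pow_lt_one hq4 four_ne_zero))
    ((mul_right_comm _ _ _).trans (thetaProd_mul_denH_mul_denG hq4))
  have hH_neg := mul_eq_mul_of_mul_eq_one (prodH_mul_denH (q := -q ^ 4) (by rwa [norm_neg]))
    ((mul_right_comm _ _ _).trans (thetaProd_mul_denH_mul_denH_neg hq4))
  have hF := F_mul_qPochhammerInf hq
  rw [show q ^ 16 = (q ^ 4) ^ 4 by ring]
  rw [show q ^ 8 = (q ^ 4) ^ 2 by ring] at hF
  refine (isUnit_qPochhammerInf hq2 hq2).mul_right_cancel ?_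
  linear_combination hG + denH (q ^ 4) * thetaProd_one_nine hq - hG_pow - q * hH_neg -
    (prodG ((q ^ 4) ^ 4) + q * prodH (-q ^ 4)) * hF

theorem prodH_eq_F_mul {q : A} (hq : ‖q‖ < 1) :
    prodH q = F q * (prodG (-q ^ 4) + q ^ 3 * prodH (q ^ 16)) := by
  have hq2 : ‖q ^ 2‖ < 1 := norm_pow_lt_one hq two_ne_zero
  have hq4 : ‖q ^ 4‖ < 1 := norm_pow_lt_one hq four_ne_zero
  have hH := mul_eq_mul_of_mul_eq_one (prodH_mul_denH hq) (thetaProd_mul_denH_mul_denG hq)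
  have hG_neg := mul_eq_mul_of_mul_eq_one (prodG_mul_denG (q := -q ^ 4) (by rwa [norm_neg]))
    ((mul_right_comm _ _ _).trans (thetaProd_mul_denG_mul_denG_neg hq4))
  have hH_pow := mul_eq_mul_of_mul_eq_one (prodH_mul_denH (norm_pow_lt_one hq4 four_ne_zero))
    ((mul_right_comm _ _ _).trans (thetaProd_mul_denG_mul_denH hq4))
  have hF := F_mul_qPochhammerInf hq
  rw [show q ^ 16 = (q ^ 4) ^ 4 by ring]
  rw [show q ^ 8 = (q ^ 4) ^ 2 by ring] at hF
  refine (isUnit_qPochhammerInf hq2 hq2).mul_right_cancel ?_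
  linear_combination hH + denG (q ^ 4) * thetaProd_three_seven hq - hG_neg - q ^ 3 * hH_pow -
    (prodG (-q ^ 4) + q ^ 3 * prodH ((q ^ 4) ^ 4)) * hF

end Normed

/-! ### Uniqueness of solutions of Rogers' equations -/

section Normed

open Asymptotics

variable {A : Type*} [NormedCommRing A] [NormOneClass A]

lemma norm_qPochhammer_sub_one_le {a q : A} (ha : ‖a‖ ≤ 1 / 2) (hq : ‖q‖ ≤ 1 / 2) (n : ℕ) :
    ‖qPochhammer a q n - 1‖ ≤ 4 * ‖a‖ := by
  have hterm (j : ℕ) : ‖-(a * q ^ j)‖ ≤ ‖a‖ * (1 / 2) ^ j := by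
    rw [norm_neg]
    exact (norm_mul_le _ _).trans (by gcongr; exact (norm_pow_le q j).trans (by gcongr))
  have hsum : ∑ j ∈ range n, ‖-(a * q ^ j)‖ ≤ 2 * ‖a‖ := by
    calc ∑ j ∈ range n, ‖-(a * q ^ j)‖ ≤ ∑ j ∈ range n, ‖a‖ * (1 / 2) ^ j :=
          sum_le_sum fun j _ => hterm j
      _ ≤ 2 * ‖a‖ := by
        rw [← mul_sum, mul_comm]
        gcongr
        exact sum_geometric_two_le n
  calc ‖qPochhammer a q n - 1‖ ≤ Real.exp (∑ j ∈ range n, ‖-(a * q ^ j)‖) - 1 := by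
        simpa only [qPochhammer, sub_eq_add_neg] using
          norm_prod_one_add_sub_one_le (range n) fun j => -(a * q ^ j)
    _ ≤ Real.exp (2 * ‖a‖) - 1 := by gcongr
    _ ≤ 2 * |2 * ‖a‖| := (le_abs_self _).trans (Real.abs_exp_sub_one_le (by
        rw [abs_of_nonneg (by positivity)]; linarith))
    _ = 4 * ‖a‖ := by rw [abs_of_nonneg (by positivity)]; ring

omit [NormOneClass A] in
lemma isBigO_one_of_isBigO_sub_one {u : A → A}
    (hu : (fun x => u x - 1) =O[𝓝 0] (norm : A → ℝ)) : u =O[𝓝 0] fun _ => (1 : ℝ) :=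
  (tendsto_sub_nhds_zero_iff.mp (hu.trans_tendsto tendsto_norm_zero)).isBigO_one ℝ

omit [NormOneClass A] in
lemma isBigO_mul_sub_one {u v : A → A} (hu : (fun x => u x - 1) =O[𝓝 0] (norm : A → ℝ))
    (hv : (fun x => v x - 1) =O[𝓝 0] (norm : A → ℝ)) :
    (fun x => u x * v x - 1) =O[𝓝 0] (norm : A → ℝ) := by
  have hmul := (isBigO_one_of_isBigO_sub_one hu).mul hv
  simp only [one_mul] at hmul
  exact (hmul.add hu).congr_left fun x => by ring

omit [NormOneClass A] in
lemma isBigO_inverse_sub_one [CompleteSpace A] {u : A → A}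
    (hu : (fun x => u x - 1) =O[𝓝 0] (norm : A → ℝ)) :
    (fun x => Ring.inverse (u x) - 1) =O[𝓝 0] (norm : A → ℝ) := by
  have htendsto : Tendsto u (𝓝 0) (𝓝 ((1 : Aˣ) : A)) :=
    tendsto_sub_nhds_zero_iff.mp (hu.trans_tendsto tendsto_norm_zero)
  have hinv := ((NormedRing.inverse_continuousAt (1 : Aˣ)).tendsto.comp htendsto).isBigO_one ℝ
  have hmul := hinv.mul hu.neg_left
  simp only [one_mul] at hmul
  refine hmul.congr' ?_ .rfl
  filter_upwards [htendsto (Units.nhds 1)] with x hx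
  rw [Function.comp_apply]
  linear_combination -Ring.inverse_mul_cancel _ hx

lemma eventually_eq_zero_of_le_mul_add {d b : A → ℝ} (hd_nonneg : ∀ x, 0 ≤ d x)
    (hd : d =O[𝓝 0] (norm : A → ℝ)) (hb : b =O[𝓝 0] fun _ => (1 : ℝ))
    (hle : ∀ x, ‖x‖ < 1 → d x ≤ b x * (d (x ^ 16) + d (-x ^ 4))) :
    ∀ᶠ x in 𝓝 0, d x = 0 := by
  obtain ⟨C, hC_pos, hC⟩ := hd.exists_pos
  obtain ⟨B, hB_pos, hB⟩ := hb.exists_pos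
  obtain ⟨ε, hε_pos, hε⟩ := Metric.eventually_nhds_iff_ball.mp (hC.bound.and hB.bound)
  obtain ⟨δ, hδ_pos, hδ⟩ := exists_between
    (show 0 < min ε (min 1 (1 / (4 * B))) by positivity)
  simp only [lt_min_iff, lt_div_iff₀ (show 0 < 4 * B by positivity)] at hδ
  simp only [mem_ball_zero_iff, norm_norm, norm_one, mul_one, Real.norm_of_nonneg (hd_nonneg _)]
    at hε
  have hbound (n : ℕ) : ∀ x : A, ‖x‖ < δ → d x ≤ C * (1 / 2) ^ n * ‖x‖ := by
    induction n with
    | zero =>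
      intro x hx
      simpa using (hε x (hx.trans hδ.1)).1
    | succ n ih =>
      intro x hx
      have hx1 : ‖x‖ < 1 := hx.trans hδ.2.1
      have hpow {y : A} (hy : ‖y‖ ≤ ‖x‖ ^ 2) : d y ≤ C * (1 / 2) ^ n * (δ * ‖x‖) := by
        have hy' : ‖y‖ ≤ δ * ‖x‖ := hy.trans (by rw [sq]; gcongr)
        exact (ih y (hy'.trans_lt (mul_lt_of_lt_one_right hδ_pos hx1))).trans (by gcongr)
      calc d x ≤ b x * (d (x ^ 16) + d (-x ^ 4)) := hle x hx1
        _ ≤ B * (C * (1 / 2) ^ n * (δ * ‖x‖) + C * (1 / 2) ^ n * (δ * ‖x‖)) :=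
          mul_le_mul ((Real.le_norm_self _).trans (hε x (hx.trans hδ.1)).2)
            (add_le_add (hpow (norm_pow_le_pow_of_le hx1 (by norm_num)))
              (hpow (by rw [norm_neg]; exact norm_pow_le_pow_of_le hx1 (by norm_num))))
            (add_nonneg (hd_nonneg _) (hd_nonneg _)) hB_pos.le
        _ = δ * (4 * B) * (C * (1 / 2) ^ (n + 1) * ‖x‖) := by ring
        _ ≤ C * (1 / 2) ^ (n + 1) * ‖x‖ := mul_le_of_le_one_left (by positivity) hδ.2.2.le
  filter_upwards [Metric.ball_mem_nhds (0 : A) hδ_pos] with x hx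
  have hlim : Tendsto (fun n : ℕ => C * (1 / 2) ^ n * ‖x‖) atTop (𝓝 0) := by
    simpa using ((tendsto_pow_atTop_nhds_zero_of_lt_one (by norm_num : (0 : ℝ) ≤ 1 / 2)
      (by norm_num)).const_mul C).mul_const ‖x‖
  exact le_antisymm (ge_of_tendsto' hlim fun n => hbound n x (mem_ball_zero_iff.mp hx))
    (hd_nonneg x)

/-- Near `0` the inequality improves a bound `d x ≤ C ‖x‖` to `d x ≤ C ‖x‖ / 2`, so `d` vanishes
there; elsewhere it leads from `x` to points of norm at most `‖x‖ ^ 2`. -/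
theorem eq_zero_of_le_mul_add {d b : A → ℝ} (hd_nonneg : ∀ x, 0 ≤ d x)
    (hd : d =O[𝓝 0] (norm : A → ℝ)) (hb : b =O[𝓝 0] fun _ => (1 : ℝ))
    (hle : ∀ x, ‖x‖ < 1 → d x ≤ b x * (d (x ^ 16) + d (-x ^ 4))) {x : A} (hx : ‖x‖ < 1) :
    d x = 0 := by
  obtain ⟨δ, hδ_pos, hδ⟩ := Metric.eventually_nhds_iff_ball.mp
    (eventually_eq_zero_of_le_mul_add hd_nonneg hd hb hle)
  have hzero (n : ℕ) : ∀ y : A, ‖y‖ < 1 → ‖y‖ ^ 2 ^ n < δ → d y = 0 := by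
    induction n with
    | zero => exact fun y _ hy => hδ y (by simpa using hy)
    | succ n ih =>
      intro y hy1 hy
      have hpow {z : A} (hz : ‖z‖ ≤ ‖y‖ ^ 2) : d z = 0 := by
        refine ih z (hz.trans_lt (pow_lt_one₀ (norm_nonneg y) hy1 two_ne_zero)) ?_
        calc ‖z‖ ^ 2 ^ n ≤ (‖y‖ ^ 2) ^ 2 ^ n := by gcongr
          _ = ‖y‖ ^ 2 ^ (n + 1) := by rw [← pow_mul, pow_succ' 2]
          _ < δ := hy
      refine le_antisymm ((hle y hy1).trans_eq ?_) (hd_nonneg y)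
      rw [hpow (norm_pow_le_pow_of_le hy1 (by norm_num)),
        hpow (by rw [norm_neg]; exact norm_pow_le_pow_of_le hy1 (by norm_num)), add_zero, mul_zero]
  obtain ⟨n, hn⟩ := exists_pow_lt_of_lt_one hδ_pos hx
  exact hzero n x hx
    ((pow_le_pow_of_le_one (norm_nonneg x) hx.le Nat.lt_two_pow_self.le).trans_lt hn)

variable [CompleteSpace A]

lemma norm_recip_le_two {q : A} (hq : ‖q‖ ≤ 1 / 8) (n : ℕ) : ‖recip q n‖ ≤ 2 := by
  have hsub : ‖1 - qPochhammer q q n‖ ≤ 1 / 2 := by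
    rw [norm_sub_rev]
    exact (norm_qPochhammer_sub_one_le (by linarith) (by linarith) n).trans (by linarith)
  calc ‖recip q n‖ = ‖Ring.inverse (1 - (1 - qPochhammer q q n))‖ := by rw [sub_sub_cancel, recip]
    _ ≤ (1 - ‖1 - qPochhammer q q n‖)⁻¹ := norm_inverse_one_sub_le (by linarith)
    _ ≤ (1 - 1 / 2)⁻¹ := by gcongr
    _ = 2 := by norm_num

lemma isBigO_tsum_pow_mul_recip_sub_one {f : ℕ → ℕ} (hf : ∀ n, n ≤ f n) (hf0 : f 0 = 0) :
    (fun x : A => ∑' n, x ^ f n * recip x n - 1) =O[𝓝 0] (norm : A → ℝ) := by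
  refine IsBigO.of_bound 4 ?_
  filter_upwards [Metric.closedBall_mem_nhds (0 : A) (by norm_num : (0 : ℝ) < 1 / 8)] with x hx
  rw [mem_closedBall_zero_iff] at hx
  have hx1 : ‖x‖ < 1 := by linarith
  have hgeom := (hasSum_geometric_of_lt_one (norm_nonneg x) hx1).mul_left (2 * ‖x‖)
  rw [(summable_pow_mul_recip hx1 hx1 hf).tsum_eq_zero_add, hf0, pow_zero, recip_zero, mul_one,
    add_sub_cancel_left]
  calc ‖∑' n, x ^ f (n + 1) * recip x (n + 1)‖ ≤ 2 * ‖x‖ * (1 - ‖x‖)⁻¹ :=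
        tsum_of_norm_bounded hgeom fun n => by
          calc ‖x ^ f (n + 1) * recip x (n + 1)‖ ≤ ‖x ^ f (n + 1)‖ * ‖recip x (n + 1)‖ :=
                norm_mul_le _ _
            _ ≤ ‖x‖ ^ (n + 1) * 2 := by
              gcongr
              exacts [norm_pow_le_pow_of_le hx1 (hf _), norm_recip_le_two hx _]
            _ = 2 * ‖x‖ * ‖x‖ ^ n := by ring
    _ ≤ 2 * ‖x‖ * 2 := by
      gcongr
      exact inv_le_of_inv_le₀ (by norm_num) (by linarith)
    _ = 4 * ‖‖x‖‖ := by rw [norm_norm]; ring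

lemma isBigO_qPochhammerInf_sub_one {m n : ℕ} (hm : m ≠ 0) (hn : n ≠ 0) :
    (fun x : A => qPochhammerInf (x ^ m) (x ^ n) - 1) =O[𝓝 0] (norm : A → ℝ) := by
  refine IsBigO.of_bound 4 ?_
  filter_upwards [Metric.closedBall_mem_nhds (0 : A) (by norm_num : (0 : ℝ) < 1 / 2)] with x hx
  rw [mem_closedBall_zero_iff] at hx
  rw [norm_norm]
  have hx1 : ‖x‖ < 1 := by linarith
  have hpow {k : ℕ} (hk : k ≠ 0) : ‖x ^ k‖ ≤ ‖x‖ := by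
    simpa only [pow_one] using norm_pow_le_pow_of_le hx1 (Nat.one_le_iff_ne_zero.mpr hk)
  have hlim := ((tendsto_qPochhammer (norm_pow_lt_one hx1 hn) (x ^ m)).sub_const 1).norm
  refine le_of_tendsto hlim (.of_forall fun k => ?_)
  exact (norm_qPochhammer_sub_one_le ((hpow hm).trans hx) ((hpow hn).trans hx) k).trans
    (by gcongr; exact hpow hm)

lemma isBigO_prodG_sub_one : (fun x : A => prodG x - 1) =O[𝓝 0] (norm : A → ℝ) := by
  have hdenG : (fun x : A => denG x - 1) =O[𝓝 0] (norm : A → ℝ) :=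
    isBigO_mul_sub_one
      (by simpa only [pow_one] using
        isBigO_qPochhammerInf_sub_one one_ne_zero (by norm_num : 5 ≠ 0))
      (isBigO_qPochhammerInf_sub_one four_ne_zero (by norm_num))
  refine (isBigO_inverse_sub_one hdenG).congr' ?_ .rfl
  filter_upwards [Metric.ball_mem_nhds (0 : A) one_pos] with x hx
  rw [prodG_eq (mem_ball_zero_iff.mp hx)]

lemma isBigO_prodH_sub_one : (fun x : A => prodH x - 1) =O[𝓝 0] (norm : A → ℝ) := by
  have hdenH : (fun x : A => denH x - 1) =O[𝓝 0] (norm : A → ℝ) :=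
    isBigO_mul_sub_one (isBigO_qPochhammerInf_sub_one two_ne_zero (by norm_num))
      (isBigO_qPochhammerInf_sub_one three_ne_zero (by norm_num))
  refine (isBigO_inverse_sub_one hdenH).congr' ?_ .rfl
  filter_upwards [Metric.ball_mem_nhds (0 : A) one_pos] with x hx
  rw [prodH_eq (mem_ball_zero_iff.mp hx)]

lemma isBigO_F : (F : A → A) =O[𝓝 0] fun _ => (1 : ℝ) := by
  refine (isBigO_one_of_isBigO_sub_one (isBigO_mul_sub_one
    (isBigO_qPochhammerInf_sub_one (by norm_num : 8 ≠ 0) (by norm_num : 8 ≠ 0))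
    (isBigO_inverse_sub_one
      (isBigO_qPochhammerInf_sub_one two_ne_zero two_ne_zero)))).congr' ?_ .rfl
  filter_upwards [Metric.ball_mem_nhds (0 : A) one_pos] with x hx
  exact (hasProd_factorF (mem_ball_zero_iff.mp hx)).tprod_eq.symm

/-- Rogers' functional equations for two functions on the unit ball of a normed ring; over `ℂ` they
are `RogersEquationsAt` at each point of the unit disc. -/
def IsRogersPair (G H : A → A) : Prop :=
  ∀ q, ‖q‖ < 1 → G q = F q * (G (q ^ 16) + q * H (-q ^ 4)) ∧
    H q = F q * (G (-q ^ 4) + q ^ 3 * H (q ^ 16))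

lemma isRogersPair_sum : IsRogersPair (sumG : A → A) sumH :=
  fun _ hq => ⟨sumG_eq_F_mul hq, sumH_eq_F_mul hq⟩

lemma isRogersPair_prod : IsRogersPair (prodG : A → A) prodH :=
  fun _ hq => ⟨prodG_eq_F_mul hq, prodH_eq_F_mul hq⟩

omit [NormOneClass A] [CompleteSpace A] in
lemma norm_mul_add_mul_sub_le {a c u u' v v' : A} (hc : ‖c‖ ≤ 1) :
    ‖a * (u + c * v) - a * (u' + c * v')‖ ≤ ‖a‖ * (‖u - u'‖ + ‖v - v'‖) := by
  calc ‖a * (u + c * v) - a * (u' + c * v')‖ = ‖a * (u - u' + c * (v - v'))‖ := by ring_nf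
    _ ≤ ‖a‖ * (‖u - u'‖ + ‖c * (v - v')‖) :=
      (norm_mul_le _ _).trans (by gcongr; exact norm_add_le _ _)
    _ ≤ ‖a‖ * (‖u - u'‖ + ‖v - v'‖) := by
      gcongr
      exact (norm_mul_le _ _).trans (mul_le_of_le_one_left (norm_nonneg _) hc)

theorem IsRogersPair.eq {G₁ H₁ G₂ H₂ : A → A} (h₁ : IsRogersPair G₁ H₁)
    (h₂ : IsRogersPair G₂ H₂) (hG : (fun x => G₁ x - G₂ x) =O[𝓝 0] (norm : A → ℝ))
    (hH : (fun x => H₁ x - H₂ x) =O[𝓝 0] (norm : A → ℝ)) {q : A} (hq : ‖q‖ < 1) :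
    G₁ q = G₂ q ∧ H₁ q = H₂ q := by
  have hzero := eq_zero_of_le_mul_add (d := fun x => ‖G₁ x - G₂ x‖ + ‖H₁ x - H₂ x‖)
    (b := fun x : A => 2 * ‖F x‖) (fun x => by positivity) (hG.norm_left.add hH.norm_left)
    (isBigO_F.norm_left.const_mul_left 2) (fun x hx => ?_) hq
  · simpa only [add_eq_zero_iff_of_nonneg (norm_nonneg _) (norm_nonneg _), norm_eq_zero,
      sub_eq_zero] using hzero
  · have hG_le := norm_mul_add_mul_sub_le (a := F x) (u := G₁ (x ^ 16)) (u' := G₂ (x ^ 16))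
      (v := H₁ (-x ^ 4)) (v' := H₂ (-x ^ 4)) hx.le
    have hH_le := norm_mul_add_mul_sub_le (a := F x) (u := G₁ (-x ^ 4)) (u' := G₂ (-x ^ 4))
      (v := H₁ (x ^ 16)) (v' := H₂ (x ^ 16)) (norm_pow_le_one hx 3)
    rw [← (h₁ x hx).1, ← (h₂ x hx).1] at hG_le
    rw [← (h₁ x hx).2, ← (h₂ x hx).2] at hH_le
    have hF_nonneg : 0 ≤ ‖F x‖ * (‖G₁ (x ^ 16) - G₂ (x ^ 16)‖ + ‖H₁ (x ^ 16) - H₂ (x ^ 16)‖ +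
        ‖G₁ (-x ^ 4) - G₂ (-x ^ 4)‖ + ‖H₁ (-x ^ 4) - H₂ (-x ^ 4)‖) := by positivity
    linarith

theorem sum_eq_prod {q : A} (hq : ‖q‖ < 1) : sumG q = prodG q ∧ sumH q = prodH q := by
  refine isRogersPair_sum.eq isRogersPair_prod ?_ ?_ hq
  · exact ((isBigO_tsum_pow_mul_recip_sub_one (Nat.le_self_pow two_ne_zero) (by norm_num)).sub
      isBigO_prodG_sub_one).congr_left fun x => sub_sub_sub_cancel_right _ _ _
  · exact ((isBigO_tsum_pow_mul_recip_sub_one (fun n => Nat.le_mul_of_pos_right n n.succ_pos)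
      (by norm_num)).sub isBigO_prodH_sub_one).congr_left fun x => sub_sub_sub_cancel_right _ _ _

theorem sumG_eq {q : A} (hq : ‖q‖ < 1) : sumG q = Ring.inverse (denG q) :=
  (sum_eq_prod hq).1.trans (prodG_eq hq)

theorem sumH_eq {q : A} (hq : ‖q‖ < 1) : sumH q = Ring.inverse (denH q) :=
  (sum_eq_prod hq).2.trans (prodH_eq hq)

end Normed

/-! ### Continuous ring homomorphisms -/

section Map

variable {A B : Type*} [CommRing A] [CommRing B] (φ : A →+* B)

lemma map_inverse_of_isUnit {x : A} (hx : IsUnit x) :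
    φ (Ring.inverse x) = Ring.inverse (φ x) :=
  (inverse_eq_of_mul_eq_one (by rw [← map_mul, Ring.mul_inverse_cancel _ hx, map_one])).symm

lemma map_qPochhammer (a q : A) (n : ℕ) :
    φ (qPochhammer a q n) = qPochhammer (φ a) (φ q) n := by
  simp only [qPochhammer, map_prod, map_sub, map_one, map_mul, map_pow]

end Map

section Transfer

variable {A B : Type*} [NormedCommRing A] [NormOneClass A] [CompleteSpace A] [CommRing B]
  (φ : A →+* B) {q : A}

lemma map_recip (hq : ‖q‖ < 1) (n : ℕ) : φ (recip q n) = recip (φ q) n := by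
  rw [recip, map_inverse_of_isUnit φ (isUnit_qPochhammer hq hq n), map_qPochhammer, recip]

omit [NormOneClass A] in
lemma map_inverse_one_sub (hq : ‖q‖ < 1) :
    φ (Ring.inverse (1 - q)) = Ring.inverse (1 - φ q) := by
  rw [map_inverse_of_isUnit φ (isUnit_one_sub_of_norm_lt_one hq), map_sub, map_one]

lemma comp_sumTermG (hq : ‖q‖ < 1) : φ ∘ sumTermG q = sumTermG (φ q) :=
  funext fun n => by
    rw [Function.comp_apply, sumTermG, ← recip, map_mul, map_pow, map_recip φ hq, sumTermG, recip]

lemma comp_sumTermH (hq : ‖q‖ < 1) : φ ∘ sumTermH q = sumTermH (φ q) :=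
  funext fun n => by
    rw [Function.comp_apply, sumTermH, ← recip, map_mul, map_pow, map_recip φ hq, sumTermH, recip]

lemma comp_prodFactorG (hq : ‖q‖ < 1) : φ ∘ prodFactorG q = prodFactorG (φ q) :=
  funext fun j => by
    simp only [Function.comp_apply, prodFactorG, Ring.mul_inverse_rev, map_mul, map_pow,
      map_inverse_one_sub φ (norm_pow_lt_one hq (Nat.succ_ne_zero _))]

lemma comp_prodFactorH (hq : ‖q‖ < 1) : φ ∘ prodFactorH q = prodFactorH (φ q) :=
  funext fun j => by
    simp only [Function.comp_apply, prodFactorH, Ring.mul_inverse_rev, map_mul, map_pow,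
      map_inverse_one_sub φ (norm_pow_lt_one hq (Nat.succ_ne_zero _))]

lemma comp_factorF (hq : ‖q‖ < 1) : φ ∘ factorF q = factorF (φ q) :=
  funext fun j => by
    simp only [Function.comp_apply, factorF, map_mul, map_sub, map_one, map_pow,
      map_inverse_one_sub φ (norm_pow_lt_one hq (Nat.succ_ne_zero _))]

variable {φ} [TopologicalSpace B] [T2Space B] (hφ : Continuous φ)
include hφ

lemma map_sumG (hq : ‖q‖ < 1) : φ (sumG q) = sumG (φ q) := by
  rw [sumG, sumG, ← comp_sumTermG φ hq]
  exact (converges_of_norm_lt_one hq).2.1.map_tsum φ hφ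

lemma map_sumH (hq : ‖q‖ < 1) : φ (sumH q) = sumH (φ q) := by
  rw [sumH, sumH, ← comp_sumTermH φ hq]
  exact (converges_of_norm_lt_one hq).2.2.1.map_tsum φ hφ

lemma map_prodG (hq : ‖q‖ < 1) : φ (prodG q) = prodG (φ q) := by
  rw [prodG, prodG, ← comp_prodFactorG φ hq]
  exact (hasProd_prodFactorG hq).multipliable.map_tprod φ hφ

lemma map_prodH (hq : ‖q‖ < 1) : φ (prodH q) = prodH (φ q) := by
  rw [prodH, prodH, ← comp_prodFactorH φ hq]
  exact (hasProd_prodFactorH hq).multipliable.map_tprod φ hφ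

lemma map_F (hq : ‖q‖ < 1) : φ (F q) = F (φ q) := by
  rw [F, F, ← comp_factorF φ hq]
  exact (hasProd_factorF hq).multipliable.map_tprod φ hφ

omit [T2Space B] in
lemma hasProd_map_qPochhammer (hq : ‖q‖ < 1) (a : A) :
    HasProd (fun j : ℕ => 1 - φ a * φ q ^ j) (φ (qPochhammerInf a q)) :=
  ((multipliable_qPochhammer hq a).hasProd.map φ hφ).congr_fun fun j => by
    simp only [Function.comp_apply, map_sub, map_one, map_mul, map_pow]

lemma map_qPochhammerInf (hq : ‖q‖ < 1) (a : A) :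
    φ (qPochhammerInf a q) = qPochhammerInf (φ a) (φ q) :=
  (hasProd_map_qPochhammer hφ hq a).tprod_eq.symm

lemma map_denG (hq : ‖q‖ < 1) : φ (denG q) = denG (φ q) := by
  simp only [denG, map_mul, map_qPochhammerInf hφ (norm_pow_lt_one hq (by norm_num : 5 ≠ 0)),
    map_pow]

lemma map_denH (hq : ‖q‖ < 1) : φ (denH q) = denH (φ q) := by
  simp only [denH, map_mul, map_qPochhammerInf hφ (norm_pow_lt_one hq (by norm_num : 5 ≠ 0)),
    map_pow]

theorem converges_map (hq : ‖q‖ < 1) : Converges (φ q) := by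
  obtain ⟨h_unit, hG, hH, hprodG, hprodH, hF, h_poch⟩ := converges_of_norm_lt_one hq
  have hq5 : ‖q ^ 5‖ < 1 := norm_pow_lt_one hq (by norm_num)
  refine ⟨fun n hn => by simpa only [map_sub, map_one, map_pow] using (h_unit n hn).map φ,
    comp_sumTermG φ hq ▸ hG.map φ hφ, comp_sumTermH φ hq ▸ hH.map φ hφ,
    comp_prodFactorG φ hq ▸ hprodG.map φ hφ, comp_prodFactorH φ hq ▸ hprodH.map φ hφ,
    comp_factorF φ hq ▸ hF.map φ hφ, fun n hn => ⟨?_, ?_⟩⟩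
  · simpa only [map_pow] using (hasProd_map_qPochhammer hφ hq5 (q ^ n)).multipliable
  · rw [← map_pow, ← map_pow, ← map_qPochhammerInf hφ hq5]
    exact (h_poch n hn).2.map φ

end Transfer

/-! ### Power series as a complete normed ring -/

/-- The ring of formal power series, as a separate type that carries the norm `2^{-order}`. -/
def XAdicSeries (S : Type*) [CommRing S] : Type _ := PowerSeries S

namespace XAdicSeries

variable {S : Type*} [CommRing S]

noncomputable instance : CommRing (XAdicSeries S) := inferInstanceAs (CommRing (PowerSeries S))

/-- The identity map to the usual ring of formal power series. -/
noncomputable def equiv : XAdicSeries S ≃+* PowerSeries S := RingEquiv.refl (PowerSeries S)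

/-- The indeterminate. -/
noncomputable def X : XAdicSeries S := equiv.symm PowerSeries.X

lemma equiv_X : equiv (X : XAdicSeries S) = PowerSeries.X := equiv.apply_symm_apply _

lemma X_pow_dvd_iff_equiv {f : XAdicSeries S} {n : ℕ} :
    X ^ n ∣ f ↔ PowerSeries.X ^ n ∣ equiv f := by
  rw [← map_dvd_iff (equiv (S := S)), map_pow, equiv_X]

lemma X_pow_dvd_iff {f : XAdicSeries S} {n : ℕ} :
    X ^ n ∣ f ↔ ∀ m < n, PowerSeries.coeff m (equiv f) = 0 := by
  rw [X_pow_dvd_iff_equiv, PowerSeries.X_pow_dvd_iff]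

lemma eq_zero_of_forall_X_pow_dvd {f : XAdicSeries S} (h : ∀ n, X ^ n ∣ f) : f = 0 :=
  (map_eq_zero_iff equiv equiv.injective).mp <|
    PowerSeries.ext fun n => X_pow_dvd_iff.mp (h (n + 1)) n n.lt_succ_self

open Classical in
/-- The norm `2^{-order}`; the zero series, whose order is infinite, has norm `0`. -/
noncomputable def normFun (f : XAdicSeries S) : ℝ :=
  if f = 0 then 0 else (1 / 2) ^ (equiv f).order.toNat

lemma normFun_zero : normFun (0 : XAdicSeries S) = 0 := if_pos rfl

lemma eq_zero_or_normFun_eq (f : XAdicSeries S) : f = 0 ∨ ∃ n : ℕ, normFun f = (1 / 2) ^ n :=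
  or_iff_not_imp_left.mpr fun h => ⟨_, if_neg h⟩

lemma normFun_nonneg (f : XAdicSeries S) : 0 ≤ normFun f := by
  rw [normFun]; split_ifs <;> positivity

lemma normFun_le_pow_iff {f : XAdicSeries S} {n : ℕ} : normFun f ≤ (1 / 2) ^ n ↔ X ^ n ∣ f := by
  by_cases hf : f = 0
  · simp only [hf, normFun_zero, dvd_zero, iff_true]
    positivity
  rw [normFun, if_neg hf, pow_le_pow_iff_right_of_lt_one₀ (by norm_num) (by norm_num),
    X_pow_dvd_iff_equiv]
  refine ⟨fun hn => (pow_dvd_pow _ hn).trans PowerSeries.X_pow_order_dvd, fun hdvd => ?_⟩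
  by_contra! hlt
  exact PowerSeries.coeff_order ((map_ne_zero_iff equiv equiv.injective).mpr hf)
    (PowerSeries.X_pow_dvd_iff.mp hdvd _ hlt)

lemma normFun_le_normFun {f g : XAdicSeries S} (h : ∀ n, X ^ n ∣ g → X ^ n ∣ f) :
    normFun f ≤ normFun g := by
  rcases eq_zero_or_normFun_eq g with rfl | ⟨n, hn⟩
  · rw [eq_zero_of_forall_X_pow_dvd fun n => h n (dvd_zero _)]
  · rw [hn, normFun_le_pow_iff]
    exact h n (normFun_le_pow_iff.mp hn.le)

lemma normFun_neg (f : XAdicSeries S) : normFun (-f) = normFun f :=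
  le_antisymm (normFun_le_normFun fun _ => dvd_neg.mpr) (normFun_le_normFun fun _ => dvd_neg.mp)

lemma normFun_add_le_right {f g : XAdicSeries S} (h : normFun f ≤ normFun g) :
    normFun (f + g) ≤ normFun g :=
  normFun_le_normFun fun _ hg =>
    dvd_add (normFun_le_pow_iff.mp (h.trans (normFun_le_pow_iff.mpr hg))) hg

lemma normFun_add_le (f g : XAdicSeries S) : normFun (f + g) ≤ normFun f + normFun g := by
  rcases le_total (normFun f) (normFun g) with h | h
  · linarith [normFun_add_le_right h, normFun_nonneg f]
  · linarith [add_comm f g ▸ normFun_add_le_right h, normFun_nonneg g]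

lemma normFun_mul_le (f g : XAdicSeries S) : normFun (f * g) ≤ normFun f * normFun g := by
  rcases eq_zero_or_normFun_eq f with rfl | ⟨m, hm⟩
  · simp only [zero_mul, normFun_zero, le_refl]
  rcases eq_zero_or_normFun_eq g with rfl | ⟨n, hn⟩
  · simp only [mul_zero, normFun_zero, le_refl]
  rw [hm, hn, ← pow_add, normFun_le_pow_iff, pow_add]
  exact mul_dvd_mul (normFun_le_pow_iff.mp hm.le) (normFun_le_pow_iff.mp hn.le)

lemma eq_zero_of_normFun_eq_zero {f : XAdicSeries S} (h : normFun f = 0) : f = 0 :=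
  eq_zero_of_forall_X_pow_dvd fun _ => normFun_le_pow_iff.mp (h.trans_le (by positivity))

/-- `normFun` as a bundled norm. -/
noncomputable def ringNorm : RingNorm (XAdicSeries S) where
  toFun := normFun
  map_zero' := normFun_zero
  add_le' := normFun_add_le
  neg' := normFun_neg
  mul_le' := normFun_mul_le
  eq_zero_of_map_eq_zero' _ := eq_zero_of_normFun_eq_zero

noncomputable instance : NormedCommRing (XAdicSeries S) :=
  { ringNorm.toNormedRing with mul_comm := mul_comm }

lemma norm_le_pow_iff {f : XAdicSeries S} {n : ℕ} : ‖f‖ ≤ (1 / 2) ^ n ↔ X ^ n ∣ f :=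
  normFun_le_pow_iff

lemma norm_X_lt_one : ‖(X : XAdicSeries S)‖ < 1 :=
  (norm_le_pow_iff.mpr (pow_one X).dvd).trans_lt (by norm_num)

instance [Nontrivial S] : NormOneClass (XAdicSeries S) where
  norm_one := by
    have hone : (1 : XAdicSeries S) ≠ 0 :=
      equiv.symm.injective.ne (one_ne_zero (α := PowerSeries S))
    change normFun 1 = 1
    rw [normFun, if_neg hone, map_one, PowerSeries.order_one, ENat.toNat_zero, pow_zero]

lemma coeff_eq_of_dist_le {f g : XAdicSeries S} {n : ℕ} (h : dist f g ≤ (1 / 2) ^ (n + 1)) :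
    PowerSeries.coeff n (equiv f) = PowerSeries.coeff n (equiv g) := by
  rw [dist_eq_norm_sub, norm_le_pow_iff, X_pow_dvd_iff] at h
  rw [← sub_eq_zero, ← map_sub, ← map_sub]
  exact h n n.lt_succ_self

instance : CompleteSpace (XAdicSeries S) := by
  refine Metric.complete_of_cauchySeq_tendsto fun u hu => ?_
  have h_stable (n : ℕ) : ∃ N, ∀ k ≥ N,
      PowerSeries.coeff n (equiv (u k)) = PowerSeries.coeff n (equiv (u N)) := by
    obtain ⟨N, hN⟩ := Metric.cauchySeq_iff'.mp hu ((1 / 2) ^ (n + 1)) (by positivity)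
    exact ⟨N, fun k hk => coeff_eq_of_dist_le (hN k hk).le⟩
  choose N hN using h_stable
  refine ⟨equiv.symm (PowerSeries.mk fun n => PowerSeries.coeff n (equiv (u (N n)))),
    Metric.tendsto_atTop.mpr fun ε hε => ?_⟩
  obtain ⟨n, hn⟩ := exists_pow_lt_of_lt_one hε (show (1 / 2 : ℝ) < 1 by norm_num)
  refine ⟨(range n).sup N, fun k hk => lt_of_le_of_lt ?_ hn⟩
  rw [dist_eq_norm_sub, norm_le_pow_iff, X_pow_dvd_iff]
  intro m hm
  rw [map_sub, map_sub, equiv.apply_symm_apply, PowerSeries.coeff_mk,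
    hN m k ((le_sup (mem_range.mpr hm)).trans hk), sub_self]

/-- Coefficient `n` of the image depends on the argument only modulo `X ^ (n + 1)`. -/
lemma continuous_of_X_dvd_map {R : Type*} [CommRing R] [TopologicalSpace R]
    (φ : XAdicSeries S →+* PowerSeries R) (hφ : PowerSeries.X ∣ φ X) : Continuous φ := by
  refine continuous_iff_continuousAt.mpr fun f =>
    (PowerSeries.WithPiTopology.tendsto_iff_coeff_tendsto R _ _ _).mpr fun n =>
      tendsto_const_nhds.congr' ?_
  filter_upwards [Metric.closedBall_mem_nhds f (by positivity : (0 : ℝ) < (1 / 2) ^ (n + 1))]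
    with g hg
  have hdvd : X ^ (n + 1) ∣ f - g := by
    rwa [← norm_le_pow_iff, ← dist_eq_norm_sub, dist_comm]
  have hdvd_map : PowerSeries.X ^ (n + 1) ∣ φ f - φ g := by
    rw [← map_sub]
    exact (pow_dvd_pow_of_dvd hφ (n + 1)).trans (map_pow φ X (n + 1) ▸ map_dvd φ hdvd)
  rw [← sub_eq_zero, ← map_sub]
  exact PowerSeries.X_pow_dvd_iff.mp hdvd_map n n.lt_succ_self

/-- The ring homomorphism that maps integral power series to power series over `R`. -/
noncomputable def toPowerSeries (R : Type*) [CommRing R] : XAdicSeries ℤ →+* PowerSeries R :=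
  (PowerSeries.map (Int.castRingHom R)).comp equiv.toRingHom

lemma toPowerSeries_X (R : Type*) [CommRing R] : toPowerSeries R X = PowerSeries.X :=
  (congrArg (PowerSeries.map (Int.castRingHom R)) equiv_X).trans (PowerSeries.map_X _)

lemma continuous_toPowerSeries (R : Type*) [CommRing R] [TopologicalSpace R] :
    Continuous (toPowerSeries R) :=
  continuous_of_X_dvd_map _ (toPowerSeries_X R).symm.dvd

end XAdicSeries

/-! ### The identities of formal power series -/

section ZeroValues

variable {A : Type*} [CommRing A] [TopologicalSpace A]

lemma sumG_zero : sumG (0 : A) = 1 := by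
  rw [sumG, tsum_eq_single 0 fun k hk => by simp [sumTermG, hk]]
  simp [sumTermG, qPochhammer_zero]

lemma sumH_zero : sumH (0 : A) = 1 := by
  rw [sumH, tsum_eq_single 0 fun k hk => by simp [sumTermH, hk]]
  simp [sumTermH, qPochhammer_zero]

end ZeroValues

section Formal

open PowerSeries (X subst constantCoeff HasSubst substAlgHom coe_substAlgHom X_dvd_iff)
open XAdicSeries (toPowerSeries toPowerSeries_X continuous_toPowerSeries continuous_of_X_dvd_map
  norm_X_lt_one)

variable {R : Type*} [CommRing R]

lemma hasSubst_of_X_dvd {a : PowerSeries R} (ha : X ∣ a) : HasSubst a :=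
  HasSubst.of_constantCoeff_zero' (X_dvd_iff.mp ha)

lemma X_pow_mul_dvd_subst {a f : PowerSeries R} {k n : ℕ} (hk : k ≠ 0) (ha : X ^ k ∣ a)
    (hf : X ^ n ∣ f) : X ^ (k * n) ∣ subst a f := by
  have hsubst := hasSubst_of_X_dvd ((dvd_pow_self X hk).trans ha)
  obtain ⟨g, rfl⟩ := hf
  rw [PowerSeries.subst_mul hsubst, PowerSeries.subst_pow hsubst, PowerSeries.subst_X hsubst,
    pow_mul]
  exact (pow_dvd_pow_of_dvd ha n).mul_right _

lemma X_dvd_X_pow_sixteen : (X : PowerSeries R) ∣ X ^ 16 :=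
  dvd_pow_self X (by norm_num)

lemma X_dvd_neg_X_pow_four : (X : PowerSeries R) ∣ -X ^ 4 :=
  (dvd_pow_self X four_ne_zero).neg_right

namespace RogersEquations

variable [TopologicalSpace R] {G H G' H' : PowerSeries R}

lemma sub (h : RogersEquations G H) (h' : RogersEquations G' H') :
    RogersEquations (G - G') (H - H') := by
  have h16 := hasSubst_of_X_dvd (X_dvd_X_pow_sixteen (R := R))
  have h4 := hasSubst_of_X_dvd (X_dvd_neg_X_pow_four (R := R))
  rw [RogersEquations, PowerSeries.subst_sub h16, PowerSeries.subst_sub h16,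
    PowerSeries.subst_sub h4, PowerSeries.subst_sub h4]
  exact ⟨by linear_combination h.1 - h'.1, by linear_combination h.2 - h'.2⟩

lemma X_pow_succ_dvd (h : RogersEquations G H) {n : ℕ} (hn : n ≠ 0) (hG : X ^ n ∣ G)
    (hH : X ^ n ∣ H) : X ^ (n + 1) ∣ G ∧ X ^ (n + 1) ∣ H := by
  have h16 {f : PowerSeries R} (hf : X ^ n ∣ f) : X ^ (n + 1) ∣ subst (X ^ 16 : PowerSeries R) f :=
    (pow_dvd_pow X (by omega)).trans (X_pow_mul_dvd_subst (by norm_num) (dvd_refl _) hf)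
  have h4 {f : PowerSeries R} (hf : X ^ n ∣ f) : X ^ (n + 1) ∣ subst (-X ^ 4 : PowerSeries R) f :=
    (pow_dvd_pow X (by omega)).trans
      (X_pow_mul_dvd_subst four_ne_zero (dvd_refl _).neg_right hf)
  constructor
  · rw [h.1]
    exact (dvd_add (h16 hG) ((h4 hH).mul_left _)).mul_left _
  · rw [h.2]
    exact (dvd_add (h4 hG) ((h16 hH).mul_left _)).mul_left _

lemma eq_zero (h : RogersEquations G H) (hG : constantCoeff G = 0) (hH : constantCoeff H = 0) :
    G = 0 ∧ H = 0 := by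
  have hdvd (n : ℕ) : X ^ (n + 1) ∣ G ∧ X ^ (n + 1) ∣ H := by
    induction n with
    | zero => simpa only [zero_add, pow_one, X_dvd_iff] using And.intro hG hH
    | succ n ih => exact h.X_pow_succ_dvd n.succ_ne_zero ih.1 ih.2
  have hzero {f : PowerSeries R} (hf : ∀ n, X ^ (n + 1) ∣ f) : f = 0 :=
    PowerSeries.ext fun n => PowerSeries.X_pow_dvd_iff.mp (hf n) n n.lt_succ_self
  exact ⟨hzero fun n => (hdvd n).1, hzero fun n => (hdvd n).2⟩

theorem eq (h : RogersEquations G H) (h' : RogersEquations G' H')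
    (hG : constantCoeff G = constantCoeff G') (hH : constantCoeff H = constantCoeff H') :
    G = G' ∧ H = H' := by
  have hzero := (h.sub h').eq_zero (by rw [map_sub, hG, sub_self]) (by rw [map_sub, hH, sub_self])
  exact ⟨sub_eq_zero.mp hzero.1, sub_eq_zero.mp hzero.2⟩

end RogersEquations

/-- The value at `a` of integral power series, for `a` without constant term. -/
noncomputable def evalAt {a : PowerSeries R} (ha : X ∣ a) : XAdicSeries ℤ →+* PowerSeries R :=
  (substAlgHom (R := R) (hasSubst_of_X_dvd ha)).toRingHom.comp (toPowerSeries R)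

variable {a : PowerSeries R}

lemma evalAt_apply (ha : X ∣ a) (f : XAdicSeries ℤ) :
    evalAt ha f = subst a (toPowerSeries R f) :=
  congrFun (coe_substAlgHom (hasSubst_of_X_dvd ha)) _

lemma evalAt_X (ha : X ∣ a) : evalAt ha XAdicSeries.X = a := by
  rw [evalAt_apply, toPowerSeries_X, PowerSeries.subst_X (hasSubst_of_X_dvd ha)]

variable [TopologicalSpace R]

lemma continuous_evalAt (ha : X ∣ a) : Continuous (evalAt ha) :=
  continuous_of_X_dvd_map _ (by rwa [evalAt_X])

variable [T2Space R]

theorem converges_of_X_dvd (ha : X ∣ a) : Converges a := by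
  simpa only [evalAt_X] using converges_map (continuous_evalAt ha) norm_X_lt_one

theorem sum_eq_prod_of_X_dvd (ha : X ∣ a) : sumG a = prodG a ∧ sumH a = prodH a := by
  have hcont := continuous_evalAt ha
  have hX : ‖(XAdicSeries.X : XAdicSeries ℤ)‖ < 1 := norm_X_lt_one
  have h := sum_eq_prod hX
  rw [← evalAt_X ha, ← map_sumG hcont hX, ← map_sumH hcont hX, ← map_prodG hcont hX,
    ← map_prodH hcont hX, h.1, h.2]
  exact ⟨rfl, rfl⟩

theorem sumG_eq_of_X_dvd (ha : X ∣ a) : sumG a = Ring.inverse (denG a) := by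
  have hcont := continuous_evalAt ha
  have h := congrArg (evalAt ha) (prodG_mul_denG norm_X_lt_one)
  rw [map_mul, map_prodG hcont norm_X_lt_one, map_denG hcont norm_X_lt_one, evalAt_X, map_one,
    mul_comm] at h
  rw [(sum_eq_prod_of_X_dvd ha).1, inverse_eq_of_mul_eq_one h]

theorem sumH_eq_of_X_dvd (ha : X ∣ a) : sumH a = Ring.inverse (denH a) := by
  have hcont := continuous_evalAt ha
  have h := congrArg (evalAt ha) (prodH_mul_denH norm_X_lt_one)
  rw [map_mul, map_prodH hcont norm_X_lt_one, map_denH hcont norm_X_lt_one, evalAt_X, map_one,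
    mul_comm] at h
  rw [(sum_eq_prod_of_X_dvd ha).2, inverse_eq_of_mul_eq_one h]

lemma subst_sumG_X (ha : X ∣ a) : subst a (sumG (X : PowerSeries R)) = sumG a := by
  rw [← toPowerSeries_X, ← map_sumG (continuous_toPowerSeries R) norm_X_lt_one, ← evalAt_apply ha,
    map_sumG (continuous_evalAt ha) norm_X_lt_one, evalAt_X]

lemma subst_sumH_X (ha : X ∣ a) : subst a (sumH (X : PowerSeries R)) = sumH a := by
  rw [← toPowerSeries_X, ← map_sumH (continuous_toPowerSeries R) norm_X_lt_one, ← evalAt_apply ha,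
    map_sumH (continuous_evalAt ha) norm_X_lt_one, evalAt_X]

lemma constantCoeff_sumG (ha : X ∣ a) : constantCoeff (sumG a) = 1 := by
  have hcont : Continuous (constantCoeff.comp (evalAt ha)) :=
    (PowerSeries.WithPiTopology.continuous_constantCoeff R).comp (continuous_evalAt ha)
  have h := map_sumG hcont norm_X_lt_one
  rwa [RingHom.comp_apply, RingHom.comp_apply, map_sumG (continuous_evalAt ha) norm_X_lt_one,
    evalAt_X, X_dvd_iff.mp ha, sumG_zero] at h

lemma constantCoeff_sumH (ha : X ∣ a) : constantCoeff (sumH a) = 1 := by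
  have hcont : Continuous (constantCoeff.comp (evalAt ha)) :=
    (PowerSeries.WithPiTopology.continuous_constantCoeff R).comp (continuous_evalAt ha)
  have h := map_sumH hcont norm_X_lt_one
  rwa [RingHom.comp_apply, RingHom.comp_apply, map_sumH (continuous_evalAt ha) norm_X_lt_one,
    evalAt_X, X_dvd_iff.mp ha, sumH_zero] at h

variable (R)

theorem rogersEquations_sum : RogersEquations (sumG (X : PowerSeries R)) (sumH X) := by
  have hcont := continuous_toPowerSeries R
  have hX : ‖(XAdicSeries.X : XAdicSeries ℤ)‖ < 1 := norm_X_lt_one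
  have hX16 := norm_pow_lt_one hX (show 16 ≠ 0 by norm_num)
  have hX4 := (norm_neg _).trans_lt (norm_pow_lt_one hX four_ne_zero)
  rw [RogersEquations, subst_sumG_X X_dvd_X_pow_sixteen, subst_sumG_X X_dvd_neg_X_pow_four,
    subst_sumH_X X_dvd_X_pow_sixteen, subst_sumH_X X_dvd_neg_X_pow_four]
  constructor
  · simpa only [map_mul, map_add, map_F hcont hX, map_sumG hcont hX, map_sumG hcont hX16,
      map_sumH hcont hX4, map_neg, map_pow, toPowerSeries_X] using
      congrArg (toPowerSeries R) (sumG_eq_F_mul hX)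
  · simpa only [map_mul, map_add, map_F hcont hX, map_sumH hcont hX, map_sumG hcont hX4,
      map_sumH hcont hX16, map_neg, map_pow, toPowerSeries_X] using
      congrArg (toPowerSeries R) (sumH_eq_F_mul hX)

theorem rogersEquations_prod : RogersEquations (prodG (X : PowerSeries R)) (prodH X) := by
  obtain ⟨hG, hH⟩ := sum_eq_prod_of_X_dvd (dvd_refl (X : PowerSeries R))
  exact hG ▸ hH ▸ rogersEquations_sum R

end Formal

end RogersRamanujan

open RogersRamanujan in
theorem mainTheorem1_general (A : Type*) [NormedCommRing A] [NormOneClass A] [CompleteSpace A] :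
    (∀ q : A, ‖q‖ < 1 →
      Converges q ∧
      sumG q = prodG q ∧
      sumH q = prodH q ∧
      sumG q = Ring.inverse (qPochhammerInf q (q ^ 5) * qPochhammerInf (q ^ 4) (q ^ 5)) ∧
      sumH q = Ring.inverse (qPochhammerInf (q ^ 2) (q ^ 5) * qPochhammerInf (q ^ 3) (q ^ 5)) ∧
      (sumG q = F q * (sumG (q ^ 16) + q * sumH (-q ^ 4)) ∧
        sumH q = F q * (sumG (-q ^ 4) + q ^ 3 * sumH (q ^ 16))) ∧
      (prodG q = F q * (prodG (q ^ 16) + q * prodH (-q ^ 4)) ∧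
        prodH q = F q * (prodG (-q ^ 4) + q ^ 3 * prodH (q ^ 16)))) ∧
    (sumG (0 : A) = 1 ∧ sumH (0 : A) = 1 ∧ prodG (0 : A) = 1 ∧ prodH (0 : A) = 1) ∧
    (∀ (R : Type*) [CommRing R] [TopologicalSpace R] [T2Space R],
      Converges (PowerSeries.X : PowerSeries R) ∧
      sumG (PowerSeries.X : PowerSeries R) = prodG PowerSeries.X ∧
      sumH (PowerSeries.X : PowerSeries R) = prodH PowerSeries.X ∧
      sumG (PowerSeries.X : PowerSeries R) =
        Ring.inverse (qPochhammerInf PowerSeries.X (PowerSeries.X ^ 5) *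
          qPochhammerInf (PowerSeries.X ^ 4) (PowerSeries.X ^ 5)) ∧
      sumH (PowerSeries.X : PowerSeries R) =
        Ring.inverse (qPochhammerInf (PowerSeries.X ^ 2) (PowerSeries.X ^ 5) *
          qPochhammerInf (PowerSeries.X ^ 3) (PowerSeries.X ^ 5)) ∧
      RogersEquations (sumG (PowerSeries.X : PowerSeries R)) (sumH PowerSeries.X) ∧
      RogersEquations (prodG (PowerSeries.X : PowerSeries R)) (prodH PowerSeries.X) ∧
      (PowerSeries.constantCoeff (sumG (PowerSeries.X : PowerSeries R)) = 1 ∧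
        PowerSeries.constantCoeff (sumH (PowerSeries.X : PowerSeries R)) = 1 ∧
        PowerSeries.constantCoeff (prodG (PowerSeries.X : PowerSeries R)) = 1 ∧
        PowerSeries.constantCoeff (prodH (PowerSeries.X : PowerSeries R)) = 1) ∧
      (∀ G H G' H' : PowerSeries R,
        RogersEquations G H → PowerSeries.constantCoeff G = 1 → PowerSeries.constantCoeff H = 1 →
        RogersEquations G' H' → PowerSeries.constantCoeff G' = 1 →
        PowerSeries.constantCoeff H' = 1 → G = G' ∧ H = H')) := by
  refine ⟨fun q hq => ?_, ?_, fun R _ _ _ => ?_⟩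
  · obtain ⟨hG, hH⟩ := sum_eq_prod hq
    exact ⟨converges_of_norm_lt_one hq, hG, hH, sumG_eq hq, sumH_eq hq,
      isRogersPair_sum q hq, isRogersPair_prod q hq⟩
  · obtain ⟨hG, hH⟩ := sum_eq_prod (q := (0 : A)) (by rw [norm_zero]; exact one_pos)
    exact ⟨sumG_zero, sumH_zero, hG.symm.trans sumG_zero, hH.symm.trans sumH_zero⟩
  · have hX : (PowerSeries.X : PowerSeries R) ∣ PowerSeries.X := dvd_refl _
    obtain ⟨hG, hH⟩ := sum_eq_prod_of_X_dvd hX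
    exact ⟨converges_of_X_dvd hX, hG, hH, sumG_eq_of_X_dvd hX, sumH_eq_of_X_dvd hX,
      rogersEquations_sum R, rogersEquations_prod R,
      ⟨constantCoeff_sumG hX, constantCoeff_sumH hX, hG ▸ constantCoeff_sumG hX,
        hH ▸ constantCoeff_sumH hX⟩,
      fun _ _ _ _ h hG₁ hH₁ h' hG₂ hH₂ => h.eq h' (hG₁.trans hG₂.symm) (hH₁.trans hH₂.symm)⟩

open RogersRamanujan in
theorem mainTheorem1 :
    -- the analytic identities
    (∀ q : ℂ, ‖q‖ < 1 →
      Converges q ∧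
      sumG q = prodG q ∧
      sumH q = prodH q ∧
      sumG q = (qPochhammerInf q (q ^ 5) * qPochhammerInf (q ^ 4) (q ^ 5))⁻¹ ∧
      sumH q = (qPochhammerInf (q ^ 2) (q ^ 5) * qPochhammerInf (q ^ 3) (q ^ 5))⁻¹ ∧
      RogersEquationsAt sumG sumH q ∧
      RogersEquationsAt prodG prodH q) ∧
    (sumG (0 : ℂ) = 1 ∧ sumH (0 : ℂ) = 1 ∧ prodG (0 : ℂ) = 1 ∧ prodH (0 : ℂ) = 1) ∧
    -- the identities of formal power series
    (∀ (R : Type*) [CommRing R] [TopologicalSpace R] [T2Space R],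
      Converges (PowerSeries.X : PowerSeries R) ∧
      sumG (PowerSeries.X : PowerSeries R) = prodG PowerSeries.X ∧
      sumH (PowerSeries.X : PowerSeries R) = prodH PowerSeries.X ∧
      sumG (PowerSeries.X : PowerSeries R) =
        Ring.inverse (qPochhammerInf PowerSeries.X (PowerSeries.X ^ 5) *
          qPochhammerInf (PowerSeries.X ^ 4) (PowerSeries.X ^ 5)) ∧
      sumH (PowerSeries.X : PowerSeries R) =
        Ring.inverse (qPochhammerInf (PowerSeries.X ^ 2) (PowerSeries.X ^ 5) *
          qPochhammerInf (PowerSeries.X ^ 3) (PowerSeries.X ^ 5)) ∧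
      RogersEquations (sumG (PowerSeries.X : PowerSeries R)) (sumH PowerSeries.X) ∧
      RogersEquations (prodG (PowerSeries.X : PowerSeries R)) (prodH PowerSeries.X) ∧
      (PowerSeries.constantCoeff (sumG (PowerSeries.X : PowerSeries R)) = 1 ∧
        PowerSeries.constantCoeff (sumH (PowerSeries.X : PowerSeries R)) = 1 ∧
        PowerSeries.constantCoeff (prodG (PowerSeries.X : PowerSeries R)) = 1 ∧
        PowerSeries.constantCoeff (prodH (PowerSeries.X : PowerSeries R)) = 1) ∧
      -- Rogers' equations and the initial values determine the pair of power series
      (∀ G H G' H' : PowerSeries R,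
        RogersEquations G H → PowerSeries.constantCoeff G = 1 → PowerSeries.constantCoeff H = 1 →
        RogersEquations G' H' → PowerSeries.constantCoeff G' = 1 →
        PowerSeries.constantCoeff H' = 1 → G = G' ∧ H = H')) := by
  simpa only [Ring.inverse_eq_inv, RogersEquationsAt] using mainTheorem1_general ℂ
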